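/- **Definitions.** Let $q$ be a prime power. A $d$-regular (multi)graph $G$ on $m$ vertices ($d\ge 1$) with adjacency eigenvalues $\lambda_1\ge\dots\ge\lambda_m$ satisfies $\lambda(G)\le\lambda$ if $|\lambda_i|\le\lambda d$ for all $i\ge 2$. A $\lambda$-pseudorandom $(m\to n)$ puncturing $\varphi$ takes a $d$-regular graph $G$ on $[m]$ (any $d$) with $\lambda(G)\le\lambda$ and a random walk $(i_1,\dots,i_n)$ on $G$ from a uniform start vertex, and sets $\varphi(u)=(u_{i_1},\dots,u_{i_n})$ (vertices may repeat). A code $C\subseteq\mathbb F_q^n$ has rate $\log_q|C|/n$, and is $(\ell,L)$-zero-error list recoverable if for all $A_1,\dots,A_n\subseteq\mathbb F_q$ with $|A_i|\le\ell$ at most $L$ codewords lie in $A_1\times\dots\times A_n$. Here $\log$ is the natural logarithm. **Theorem.** (1) There is an absolute constant $c>0$ such that for every $\eta>0$ there are constants $C,\rho,\gamma>0$ depending only on $\eta$ with the following property. Let $\alpha\in(0,1]$, let $D\subseteq\mathbb F_q^m$ be a nonzero linear code with minimum distance at least $m(1-1/q-\varepsilon^2)$, and assume $$\frac1{\sqrt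 q}\le\varepsilon\le\min(c,\alpha/4),\qquad \ell\le\frac{\alpha}{4\varepsilon^2},\qquad\text{and}\qquad \alpha\le 1-\eta\ \text{ or }\ \ell\le(1-\eta)\frac{\alpha}{4\varepsilon^2}.$$ Let $K\ge C$ and $n=\lceil K\log|D|/\varepsilon\rceil$, and let $\varphi$ be a $1/4$-pseudorandom $(m\to n)$ puncturing. Then with probability at least $1-e^{-\gamma n}$ the code $\varphi(D)$ has rate at least $\rho\,\varepsilon/(K\log q)$ and is $(\ell,(1+\alpha)\ell)$-zero-error list recoverable. (2) There are absolute constants $\kappa,C,\rho,\gamma,A,B>0$ and $d_0\in\mathbb N$ such that the following holds for every prime power $q$, every $1/\sqrt q\le\varepsilon\le1$ and every integer $k\ge1$ with $k-1\le\kappa\varepsilon^2q$. Let $n=\lceil Ck\log q/\varepsilon\rceil$. There is a $d$-regular graph $G$ on the vertex set $\mathbb F_q$ with $d\le d_0$ and $\lambda(G)\le1/4$, and a walk $(x_1,\dots,x_n)$ on any $d$-regular graph on $\mathbb F_q$ with $d\le d_0$ is sampled with at most $Bn$ random bits (that is, by a uniform element of a set of size $q\,d^{\,n-1}\le 2^{Bn}$).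 For every regular graph $G$ on $\mathbb F_q$ with $\lambda(G)\le1/4$, with probability at least $1-e^{-\gamma n}$ over a random walk $(x_1,\dots,x_n)$ on $G$, the Reed–Solomon code $\{(p(x_1),\dots,p(x_n)):p\in\mathbb F_q[X],\ \deg p<k\}$ has rate at least $\rho\,\varepsilon/\log q$ and is $(\varepsilon^{-2},A\varepsilon^{-2})$-zero-error list recoverable; moreover, if $k\ge2$ and $\varepsilon\log q\le\rho$, it is beyond the Johnson bound: its relative minimum distance is at most $1-\varepsilon^{2}=1-1/\ell$ for $\ell=\varepsilon^{-2}$. -/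

import Mathlib

/-- A `d`-regular undirected (multi)graph on `V`, with `d ≥ 1`, in which the edge ends at each vertex
are labelled by `Fin d`: `nbr u a` is the neighbour of `u` along its edge with label `a`.
Symmetry says that there are as many edges from `u` to `v` as from `v` to `u`. -/
structure RegularGraph (V : Type) (d : ℕ) where
  nbr : V → Fin d → V
  symm : ∀ u v : V, Nat.card {a : Fin d // nbr u a = v} = Nat.card {a : Fin d // nbr v a = u}
  degree_pos : 0 < d

namespace RegularGraph

variable {V : Type} {d : ℕ}

/-- The adjacency matrix: entry `(u, v)` is the number of edges joining `u` to `v`. -/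
noncomputable def adjMatrix (G : RegularGraph V d) : Matrix V V ℝ :=
  Matrix.of fun u v => (Nat.card {a : Fin d // G.nbr u a = v} : ℝ)

theorem adjMatrix_isHermitian (G : RegularGraph V d) : G.adjMatrix.IsHermitian := by
  ext u v
  simp [adjMatrix, G.symm v u]

open Classical in
/-- `λ(G) ≤ lam`: with the eigenvalues of the adjacency matrix listed in decreasing order
`λ₁ ≥ λ₂ ≥ … ≥ λ_m` (with multiplicity), all of them except `λ₁` have absolute value at most
`lam * d`; this is the same as `|λ₂|, |λ_m| ≤ lam * d`. -/
def IsExpander [Fintype V] (G : RegularGraph V d) (lam : ℝ) : Prop :=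
  ∀ i : Fin (Fintype.card V), (i : ℕ) ≠ 0 →
    |G.adjMatrix_isHermitian.eigenvalues₀ i| ≤ lam * d

/-- The position after `j` steps of the walk that starts at `v` and follows the edge labels
`s 0, s 1, …`. -/
def position (G : RegularGraph V d) (v : V) {k : ℕ} (s : Fin k → Fin d) : ℕ → V
  | 0 => v
  | j + 1 =>
    if h : j < k then G.nbr (G.position v s j) (s ⟨j, h⟩) else G.position v s j

end RegularGraph

/-- The seeds of a random walk visiting `n` vertices: a start vertex and `n - 1` edge labels. -/
abbrev WalkSeed (V : Type) (d n : ℕ) : Type := V × (Fin (n - 1) → Fin d)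

/-- The `n` vertices `(i₁, …, iₙ)` visited by the walk with a given seed. -/
def RegularGraph.walk {V : Type} {d : ℕ} (G : RegularGraph V d) (n : ℕ)
    (ω : WalkSeed V d n) : Fin n → V :=
  fun j => G.position ω.1 ω.2 j

/-- The probability that the vertices of a random walk of length `n` on `G` satisfy `P`, where the
start vertex and the edge labels are independent and uniform. -/
noncomputable def RegularGraph.walkProb {V : Type} {d : ℕ} (G : RegularGraph V d) (n : ℕ)
    (P : (Fin n → V) → Prop) : ℝ :=
  (Nat.card {ω : WalkSeed V d n // P (G.walk n ω)} : ℝ) / (Nat.card (WalkSeed V d n) : ℝ)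

/-- The punctured code `φ(D)` where `φ(u) = (u_{i₁}, …, u_{iₙ})`. -/
def puncturedCode {F V : Type} {n : ℕ} (D : Set (V → F)) (i : Fin n → V) : Set (Fin n → F) :=
  (fun (u : V → F) (j : Fin n) => u (i j)) '' D

/-- The rate `log_q |C| / n` of a code `C ⊆ F^n`, `q = |F|`. -/
noncomputable def codeRate {F : Type} {n : ℕ} (C : Set (Fin n → F)) : ℝ :=
  Real.logb (Nat.card F : ℝ) (C.ncard : ℝ) / n

/-- `(ℓ, L)` zero-error list recoverability. -/
def ZeroErrorListRecoverable {F : Type} {n : ℕ} (C : Set (Fin n → F)) (ℓ L : ℝ) : Prop :=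
  ∀ A : Fin n → Finset F, (∀ i, ((A i).card : ℝ) ≤ ℓ) →
    ({c ∈ C | ∀ i, c i ∈ A i}.ncard : ℝ) ≤ L

/-- The linear code of all evaluation vectors `(p(x))_{x ∈ F}` of polynomials `p` of degree less
than `k`. Puncturing it to `(x₁, …, xₙ)` gives the Reed–Solomon code with these evaluation points. -/
noncomputable def reedSolomon (F : Type) [Field F] (k : ℕ) : Submodule F (F → F) :=
  (Polynomial.degreeLT F k).map (LinearMap.pi fun x : F => Polynomial.leval x)

open Classical in
/-- The code lies beyond the Johnson bound for zero-error list recovery with input lists of size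
`ℓ`. The Johnson bound applies to codes of relative distance greater than `1 - 1/ℓ`; here two
distinct codewords have relative distance at most `1 - 1/ℓ`. -/
def BeyondJohnson {F : Type} {n : ℕ} (C : Set (Fin n → F)) (ℓ : ℝ) : Prop :=
  ∃ c ∈ C, ∃ c' ∈ C, c ≠ c' ∧ (hammingDist c c' : ℝ) ≤ (1 - 1 / ℓ) * n

/-!
Call two codewords colliding at a coordinate if they agree there. Everything follows from one event
for the puncturing `i`, `FewCollisions`: for *every* finite set `T` of codewords of `D`, the number
of positions `j` at which two words of `T` collide is less than
`(1 + ξ) (θ (#T choose 2) + ξ² / 8) n`, where `θ` bounds the fraction of coordinates in which two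
words of `D` agree.

*The event is likely* (`RegularGraph.walkProb_fewCollisions_ge`). For fixed `T` the coordinates with
a collision have density at most `θ (#T choose 2)`, so a Chernoff bound for random walks on
expanders (`RegularGraph.walkProb_visits_le`) makes a violation exponentially unlikely in
`(θ (#T)² + ξ²) n ≳ #T √θ n`. With `n ≳ log |D| / √θ` this beats the `|D| ^ #T` choices of `T`; this
is where the rate `≈ √θ ≈ ε` instead of `ε²` comes from. The Chernoff bound comes from a two-term
recursion for the mean and for the mean-zero part of the moment generating function.

*The event suffices.* Pairs `T` show that puncturing is injective, which gives the rate. For list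
recovery suppose that a set `U` of more than `(1 + α) ℓ` codewords fits into lists of size `ℓ`. Then
at each position the words of `U` take at most `ℓ` values, so by a birthday bound
(`bernoulliExp_injOn_le`) a random subset `S` of `U` containing each word with probability `p` is
free of collisions with probability at most `(1 - p²) ^ (#U - ℓ)`, whereas `#S choose 2` has mean
`p² (#U choose 2)`. For `p²` of order `ξ / (#U - ℓ)` the comparison of the two means yields a set `S`
that violates the event (`exists_collisionCount_ge`). The point of sampling is that `U` may have
about `1 / ε²` words, while `S` has only about `1 / ε`.

*Expanders.* Expanders of bounded degree on a vertex set of any size are built by iterating the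
zig-zag product (`LabelledGraph.HasGap.zigzag`) from a base graph on `K⁸` whose edges are the
multiples of points of the moment curve (`LabelledGraph.exists_base`). Since any eight distinct
points of the curve span `K⁸`, eight steps of that walk average out almost everything. The resulting
sizes form a geometric progression; vertices are merged in bounded groups to reach the size wanted,
and a power of the adjacency matrix restores the gap (`RegularGraph.exists_isExpander`).

A walk on `G` interacts with the eigenvalue condition only through the contraction of functions of
mean zero by the averaging operator, to which it is equivalent (`RegularGraph.IsExpander.hasGap`,
`RegularGraph.HasGap.isExpander`).
-/

open Finset

/-! ### A Chernoff bound for walks on expanders -/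

/-- The Euclidean norm of a real function on a finite type. -/
noncomputable def nrm {V : Type} [Fintype V] (f : V → ℝ) : ℝ := √(∑ v, f v ^ 2)

section nrm
variable {V : Type} [Fintype V]

theorem nrm_nonneg (f : V → ℝ) : 0 ≤ nrm f := Real.sqrt_nonneg _

theorem nrm_sq (f : V → ℝ) : nrm f ^ 2 = ∑ v, f v ^ 2 :=
  Real.sq_sqrt (sum_nonneg fun _ _ => sq_nonneg _)

theorem nrm_eq_norm (f : V → ℝ) : nrm f = ‖WithLp.toLp 2 f‖ := by
  rw [EuclideanSpace.norm_eq]; simp [nrm]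

theorem nrm_add_le (f g : V → ℝ) : nrm (f + g) ≤ nrm f + nrm g := by
  simp only [nrm_eq_norm, WithLp.toLp_add]; exact norm_add_le _ _

theorem nrm_sum_le {ι : Type*} (s : Finset ι) (f : ι → V → ℝ) :
    nrm (∑ i ∈ s, f i) ≤ ∑ i ∈ s, nrm (f i) := by
  simp only [nrm_eq_norm, WithLp.toLp_sum]; exact norm_sum_le _ _

theorem nrm_smul (c : ℝ) (f : V → ℝ) : nrm (c • f) = |c| * nrm f := by
  simp only [nrm_eq_norm, WithLp.toLp_smul, norm_smul, Real.norm_eq_abs]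

theorem nrm_zero : nrm (0 : V → ℝ) = 0 := by simp [nrm]

theorem nrm_le_of_sq_le {f g : V → ℝ} {c : ℝ} (hc : 0 ≤ c)
    (h : ∑ v, f v ^ 2 ≤ c ^ 2 * ∑ v, g v ^ 2) : nrm f ≤ c * nrm g := by
  refine abs_le_of_sq_le_sq' ?_ (mul_nonneg hc (nrm_nonneg _)) |>.2
  rw [mul_pow, nrm_sq, nrm_sq]; exact h

theorem sum_mul_le_nrm (f g : V → ℝ) : ∑ v, f v * g v ≤ nrm f * nrm g :=
  Real.sum_mul_le_sqrt_mul_sqrt _ _ _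

/-- The mean is the constant closest to a function in the Euclidean norm. -/
theorem nrm_sub_mean_le (f : V → ℝ) (a c : ℝ) (ha : ∑ v, f v = Fintype.card V * a) :
    nrm (fun v => f v - a) ≤ nrm (fun v => f v - c) := by
  refine Real.sqrt_le_sqrt ?_
  have key : ∀ x : ℝ, ∑ v, (f v - x) ^ 2
      = ∑ v, f v ^ 2 - 2 * x * (Fintype.card V * a) + Fintype.card V * x ^ 2 := by
    intro x
    rw [← ha, mul_sum, ← sum_sub_distrib, ← card_univ, ← nsmul_eq_mul, ← sum_const,
      ← sum_add_distrib]
    exact sum_congr rfl fun v _ => by ring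
  rw [key, key]
  have : (0 : ℝ) ≤ Fintype.card V * (a - c) ^ 2 := by positivity
  linarith

end nrm

namespace RegularGraph

variable {V : Type} {d : ℕ}

theorem position_succ (G : RegularGraph V d) (v : V) {k : ℕ} (s : Fin k → Fin d) (j : ℕ) :
    G.position v s (j + 1) =
      if h : j < k then G.nbr (G.position v s j) (s ⟨j, h⟩) else G.position v s j := rfl

theorem position_cons (G : RegularGraph V d) (v : V) {k : ℕ} (a : Fin d) (s : Fin k → Fin d)
    (j : ℕ) :
    G.position v (Fin.cons a s : Fin (k + 1) → Fin d) (j + 1) = G.position (G.nbr v a) s j := by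
  induction j with
  | zero => simp [position]
  | succ j ih =>
    by_cases h : j < k
    · rw [position_succ, dif_pos (Nat.succ_lt_succ h), ih, position_succ, dif_pos h]
      congr 1
    · rw [position_succ, dif_neg (by omega), ih, position_succ, dif_neg h]

/-- The transition operator of the simple random walk: the average over the neighbours. -/
noncomputable def avg (G : RegularGraph V d) (f : V → ℝ) (v : V) : ℝ :=
  (∑ a, f (G.nbr v a)) / d

theorem degree_cast_pos (G : RegularGraph V d) : (0 : ℝ) < d := Nat.cast_pos.2 G.degree_pos

theorem avg_add (G : RegularGraph V d) (f g : V → ℝ) : G.avg (f + g) = G.avg f + G.avg g := by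
  ext v; simp [avg, sum_add_distrib, add_div]

theorem avg_const (G : RegularGraph V d) (c : ℝ) : G.avg (fun _ => c) = fun _ => c := by
  have := G.degree_cast_pos
  ext v; simp only [avg, sum_const, card_univ, Fintype.card_fin, nsmul_eq_mul]
  field_simp

theorem avg_nonneg (G : RegularGraph V d) {f : V → ℝ} (hf : ∀ v, 0 ≤ f v) (v : V) :
    0 ≤ G.avg f v :=
  div_nonneg (sum_nonneg fun _ _ => hf _) (Nat.cast_nonneg _)

variable [Fintype V]

theorem adjMatrix_mulVec (G : RegularGraph V d) (f : V → ℝ) (v : V) :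
    G.adjMatrix.mulVec f v = ∑ a, f (G.nbr v a) := by
  classical
  rw [← sum_fiberwise univ (G.nbr v) fun a => f (G.nbr v a)]
  simp only [Matrix.mulVec, dotProduct, adjMatrix, Matrix.of_apply]
  refine sum_congr rfl fun u _ => ?_
  rw [Nat.card_eq_fintype_card, Fintype.card_subtype, ← nsmul_eq_mul, ← sum_const]
  exact sum_congr rfl fun a ha => by rw [(mem_filter.1 ha).2]

theorem avg_eq_mulVec (G : RegularGraph V d) (f : V → ℝ) :
    G.avg f = (d : ℝ)⁻¹ • G.adjMatrix.mulVec f := by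
  ext v; simp [avg, adjMatrix_mulVec, div_eq_inv_mul]

theorem sum_avg (G : RegularGraph V d) (f : V → ℝ) : ∑ v, G.avg f v = ∑ v, f v := by
  have hd := G.degree_cast_pos
  have h1 : G.adjMatrix.mulVec (fun _ => (1 : ℝ)) = fun _ => (d : ℝ) := by
    ext v; simp [adjMatrix_mulVec]
  have hT : G.adjMatrix.transpose = G.adjMatrix := by
    simpa [Matrix.IsHermitian] using G.adjMatrix_isHermitian
  have h2 : (fun _ => (1 : ℝ)) ⬝ᵥ G.adjMatrix.mulVec f = d * ∑ v, f v := by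
    rw [Matrix.dotProduct_mulVec, ← Matrix.mulVec_transpose, hT, h1]
    simp [dotProduct, mul_sum]
  rw [avg_eq_mulVec]
  simp only [Pi.smul_apply, smul_eq_mul, ← mul_sum]
  simp only [dotProduct, one_mul] at h2
  rw [h2]; field_simp

/-- `HasGap G lam`: the transition operator shrinks functions of mean zero by the factor `lam`. -/
def HasGap (G : RegularGraph V d) (lam : ℝ) : Prop :=
  ∀ g : V → ℝ, ∑ v, g v = 0 → nrm (G.avg g) ≤ lam * nrm g

/-- `G.expWeight w k v` is the expected product of the weights `w` over the first `k` vertices of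
the random walk started at `v`. -/
noncomputable def expWeight (G : RegularGraph V d) (w : V → ℝ) : ℕ → V → ℝ
  | 0 => fun _ => 1
  | k + 1 => fun v => w v * G.avg (G.expWeight w k) v

omit [Fintype V] in
theorem expWeight_nonneg (G : RegularGraph V d) {w : V → ℝ} (hw : ∀ v, 0 ≤ w v) (k : ℕ) (v : V) :
    0 ≤ G.expWeight w k v := by
  induction k generalizing v with
  | zero => simp [expWeight]
  | succ k ih => exact mul_nonneg (hw v) (G.avg_nonneg ih v)

omit [Fintype V] in
theorem sum_prod_position (G : RegularGraph V d) (w : V → ℝ) (k : ℕ) (v : V) :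
    ∑ s : Fin k → Fin d, ∏ j ∈ range (k + 1), w (G.position v s j)
      = (d : ℝ) ^ k * G.expWeight w (k + 1) v := by
  have hd := G.degree_cast_pos
  induction k generalizing v with
  | zero => simp [position, expWeight, avg_const]
  | succ k ih =>
    rw [← (Fin.consEquiv fun _ : Fin (k + 1) => Fin d).sum_comp, Fintype.sum_prod_type]
    have : ∀ (a : Fin d) (s : Fin k → Fin d),
        ∏ j ∈ range (k + 1 + 1), w (G.position v
          ((Fin.consEquiv fun _ : Fin (k + 1) => Fin d) (a, s)) j)
        = w v * ∏ j ∈ range (k + 1), w (G.position (G.nbr v a) s j) := by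
      intro a s
      rw [prod_range_succ', mul_comm]
      congr 1
      exact prod_congr rfl fun j _ => by rw [← position_cons]; rfl
    simp_rw [this, ← mul_sum, ih]
    change _ = (d : ℝ) ^ (k + 1) * (w v * ((∑ a, G.expWeight w (k + 1) (G.nbr v a)) / d))
    rw [← mul_sum]
    field_simp
    ring

theorem sum_prod_walk (G : RegularGraph V d) (w : V → ℝ) (k : ℕ) :
    ∑ ω : WalkSeed V d (k + 1), ∏ j, w (G.walk (k + 1) ω j)
      = (d : ℝ) ^ k * ∑ v, G.expWeight w (k + 1) v := by
  rw [Fintype.sum_prod_type, mul_sum]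
  refine sum_congr rfl fun v _ => ?_
  rw [← G.sum_prod_position w k v]
  refine sum_congr rfl fun s _ => ?_
  exact Fin.prod_univ_eq_prod_range (fun j => w (G.position v s j)) (k + 1)

/-- One step of the moment recursion. Write a function `h` as its mean `a` plus a part of
normalized norm `b`; the walk shrinks that part by `1/4`, and multiplying by the weight
`1 + σ 1_B` mixes the two parts by an amount controlled by the density `β` of `B`. -/
theorem weight_step (G : RegularGraph V d) (hG : G.HasGap (1 / 4)) [DecidableEq V] (B : Finset V)
    {σ β a b : ℝ} (hσ : 0 ≤ σ) (hσ1 : σ ≤ 1) (hB : (B.card : ℝ) ≤ β * Fintype.card V)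
    (h : V → ℝ) (hm : ∑ v, h v = Fintype.card V * a) (ha : 0 ≤ a)
    (hb : nrm (fun v => h v - a) ≤ √(Fintype.card V) * b) {a' : ℝ}
    (hm' : ∑ v, (1 + σ * if v ∈ B then 1 else 0) * G.avg h v = Fintype.card V * a') :
    Fintype.card V * a' ≤ Fintype.card V * ((1 + σ * β) * a + σ * √β * b / 4) ∧
    nrm (fun v => (1 + σ * if v ∈ B then 1 else 0) * G.avg h v - a')
      ≤ √(Fintype.card V) * (σ * √β * a + b / 2) := by
  set N : ℝ := (Fintype.card V : ℝ) with hN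
  set χ : V → ℝ := fun v => if v ∈ B then 1 else 0 with hχ
  have hN0 : 0 ≤ N := Nat.cast_nonneg _
  set g : V → ℝ := fun v => h v - a with hg
  have hg0 : ∑ v, g v = 0 := by simp [hg, hm, hN]
  have hh : h = (fun _ => a) + g := by ext v; simp [hg]
  have hav : ∀ v, G.avg h v = a + G.avg g v := by
    intro v; rw [hh, avg_add, avg_const]; rfl
  have hg' : nrm (G.avg g) ≤ √N * b / 4 := by
    have := hG g hg0
    linarith
  have hs0 : ∑ v, G.avg g v = 0 := by rw [sum_avg, hg0]
  have hχs : ∑ v, χ v = B.card := by simp [hχ]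
  have hχn : nrm χ ≤ √β * √N := by
    rw [← Real.sqrt_mul' _ hN0]
    refine Real.sqrt_le_sqrt ?_
    have : ∑ v, χ v ^ 2 = B.card := by rw [← hχs]; exact sum_congr rfl fun v _ => by simp [hχ]
    rw [this]; exact hB
  have hsN : √N * √N = N := Real.mul_self_sqrt hN0
  have hχg : nrm (fun v => χ v * G.avg g v) ≤ nrm (G.avg g) := by
    refine Real.sqrt_le_sqrt (sum_le_sum fun v _ => ?_)
    by_cases hv : v ∈ B <;> simp [hχ, hv, sq_nonneg]
  constructor
  · rw [← hm']
    have e : ∀ v, (1 + σ * χ v) * G.avg h v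
        = a + G.avg g v + σ * a * χ v + σ * (χ v * G.avg g v) := by
      intro v; rw [hav]; ring
    refine (sum_congr rfl fun v _ => e v).trans_le ?_
    simp_rw [sum_add_distrib, ← mul_sum, hs0, hχs]
    have h1 : ∑ v, χ v * G.avg g v ≤ √β * √N * (√N * b / 4) :=
      (sum_mul_le_nrm _ _).trans (mul_le_mul hχn hg' (nrm_nonneg _) (by positivity))
    have h2 := mul_le_mul_of_nonneg_left h1 hσ
    have h3 := mul_le_mul_of_nonneg_left hB (mul_nonneg hσ ha)
    have h4 : σ * (√β * √N * (√N * b / 4)) = N * (σ * √β * b / 4) := by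
      calc _ = √N * √N * (σ * √β * b / 4) := by ring
        _ = _ := by rw [hsN]
    simp only [sum_const, card_univ, nsmul_eq_mul]
    rw [h4] at h2
    nlinarith
  · refine (nrm_sub_mean_le _ _ a hm').trans ?_
    have e : (fun v => (1 + σ * χ v) * G.avg h v - a)
        = G.avg g + ((σ * a) • χ + σ • fun v => χ v * G.avg g v) := by
      ext v; simp only [Pi.add_apply, Pi.smul_apply, smul_eq_mul, hav]; ring
    rw [e]
    refine (nrm_add_le _ _).trans ((add_le_add_right (nrm_add_le _ _) _).trans ?_)
    rw [nrm_smul, nrm_smul, abs_of_nonneg hσ, abs_of_nonneg (mul_nonneg hσ ha)]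
    have h1 := mul_le_mul_of_nonneg_left hχn (mul_nonneg hσ ha)
    have h2 := mul_le_mul_of_nonneg_right hσ1 (nrm_nonneg (G.avg g))
    have h3 := mul_le_mul_of_nonneg_left hχg hσ
    nlinarith

/-- A bound on the moment generating function of the number of visits to a set of density at most
`β`. Along the recursion of `weight_step` the mean is at most `μ ^ k`, and the part of mean zero stays
smaller than that by a factor of order `σ √β`. -/
theorem sum_expWeight_le (G : RegularGraph V d) (hG : G.HasGap (1 / 4)) [DecidableEq V]
    [Nonempty V] (B : Finset V) {σ β : ℝ} (hσ : 0 ≤ σ) (hσ1 : σ ≤ 1) (hβ : 0 ≤ β)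
    (hB : (B.card : ℝ) ≤ β * Fintype.card V) (k : ℕ) :
    ∑ v, G.expWeight (fun v => 1 + σ * if v ∈ B then 1 else 0) k v
      ≤ Fintype.card V * (1 + σ * β + σ ^ 2 * β / 2) ^ k := by
  set N : ℝ := (Fintype.card V : ℝ) with hN
  set μ : ℝ := 1 + σ * β + σ ^ 2 * β / 2 with hμ
  set w : V → ℝ := fun v => 1 + σ * if v ∈ B then 1 else 0 with hw
  have hN0 : 0 < N := Nat.cast_pos.2 Fintype.card_pos
  have hμ1 : 1 ≤ μ := by
    have : 0 ≤ σ * β + σ ^ 2 * β / 2 := by positivity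
    linarith
  have hw0 : ∀ v, 0 ≤ w v := fun v => by
    by_cases hv : v ∈ B <;> simp [hw, hv]; linarith
  have hββ : √β * √β = β := Real.mul_self_sqrt hβ
  suffices H : ∀ k, ∃ a, ∑ v, G.expWeight w k v = N * a ∧ a ≤ μ ^ k ∧
      nrm (fun v => G.expWeight w k v - a) ≤ √N * (2 * σ * √β * μ ^ k) by
    obtain ⟨a, h1, h2, -⟩ := H k
    rw [h1]; exact mul_le_mul_of_nonneg_left h2 hN0.le
  intro k
  induction k with
  | zero =>
    refine ⟨1, by simp [expWeight, hN], by simp, ?_⟩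
    simp only [expWeight, sub_self]
    rw [show (fun _ : V => (0 : ℝ)) = 0 from rfl, nrm_zero]
    positivity
  | succ k ih =>
    obtain ⟨a, h1, h2, h3⟩ := ih
    have ha : 0 ≤ a := by
      have : 0 ≤ N * a := h1 ▸ sum_nonneg fun v _ => G.expWeight_nonneg hw0 k v
      exact nonneg_of_mul_nonneg_right this hN0
    set a' : ℝ := (∑ v, G.expWeight w (k + 1) v) / N with ha'
    have hm' : ∑ v, G.expWeight w (k + 1) v = N * a' := by rw [ha']; field_simp
    obtain ⟨h4, h5⟩ := G.weight_step hG B hσ hσ1 hB _ h1 ha h3 (a' := a') hm'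
    refine ⟨a', hm', ?_, h5.trans ?_⟩
    · have h4' := le_of_mul_le_mul_left h4 hN0
      refine h4'.trans ?_
      have : σ * √β * (2 * σ * √β * μ ^ k) / 4 = σ ^ 2 * β / 2 * μ ^ k := by
        calc _ = σ ^ 2 * (√β * √β) / 2 * μ ^ k := by ring
          _ = _ := by rw [hββ]
      have h6 := mul_le_mul_of_nonneg_left h2 (show 0 ≤ 1 + σ * β by positivity)
      rw [this, pow_succ]
      calc _ ≤ (1 + σ * β) * μ ^ k + σ ^ 2 * β / 2 * μ ^ k := by linarith
        _ = _ := by rw [hμ]; ring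
    · refine mul_le_mul_of_nonneg_left ?_ (Real.sqrt_nonneg _)
      have h6 := mul_le_mul_of_nonneg_left h2 (show 0 ≤ σ * √β by positivity)
      have h7 : μ ^ k ≤ μ ^ (k + 1) := pow_le_pow_right₀ hμ1 (Nat.le_succ k)
      have h8 := mul_le_mul_of_nonneg_left h7 (show 0 ≤ 2 * σ * √β by positivity)
      linarith

theorem walkProb_eq (G : RegularGraph V d) (n : ℕ) (P : (Fin n → V) → Prop)
    [DecidablePred P] : G.walkProb n P
      = (#{ω : WalkSeed V d n | P (G.walk n ω)} : ℝ) / Fintype.card (WalkSeed V d n) := by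
  rw [walkProb, Nat.card_eq_fintype_card, Nat.card_eq_fintype_card, Fintype.card_subtype]

/-- Chernoff bound for random walks on expanders: a set of density at most `β` is visited at least
`(1 + ξ) β n` times with probability at most `exp (-ξ² β n / 8)`. -/
theorem walkProb_visits_le (G : RegularGraph V d) (hG : G.HasGap (1 / 4)) [DecidableEq V]
    [Nonempty V] (B : Finset V) {ξ β : ℝ} (hξ : 0 ≤ ξ) (hξ1 : ξ ≤ 1) (hβ : 0 ≤ β)
    (hB : (B.card : ℝ) ≤ β * Fintype.card V) {n : ℕ} (hn : 0 < n) :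
    G.walkProb n (fun i => (1 + ξ) * β * n ≤ (#{j | i j ∈ B} : ℝ))
      ≤ Real.exp (-(ξ ^ 2 * β * n / 8)) := by
  classical
  obtain ⟨k, rfl⟩ : ∃ k, n = k + 1 := ⟨n - 1, by omega⟩
  have hd := G.degree_cast_pos
  set n : ℕ := k + 1 with hnk
  -- a nearly optimal parameter of the moment generating function `(1 + σ) ^ visits`
  set σ : ℝ := ξ / 4 with hσ
  have hσ0 : 0 ≤ σ := by positivity
  have hσ1 : σ ≤ 1 := by rw [hσ]; linarith
  set w : V → ℝ := fun v => 1 + σ * if v ∈ B then 1 else 0 with hw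
  have hN0 : (0 : ℝ) < Fintype.card V := Nat.cast_pos.2 Fintype.card_pos
  have hcard : (Fintype.card (WalkSeed V d n) : ℝ) = Fintype.card V * (d : ℝ) ^ k := by
    rw [Fintype.card_prod]; simp [hnk]
  have hmgf : ∑ ω : WalkSeed V d n, ∏ j, w (G.walk n ω j)
      ≤ Fintype.card (WalkSeed V d n) * Real.exp ((σ * β + σ ^ 2 * β / 2) * n) := by
    rw [G.sum_prod_walk w k, hcard, mul_comm (Fintype.card V : ℝ), mul_assoc]
    refine mul_le_mul_of_nonneg_left ?_ (by positivity)
    refine (G.sum_expWeight_le hG B hσ0 hσ1 hβ hB _).trans ?_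
    refine mul_le_mul_of_nonneg_left ?_ hN0.le
    rw [mul_comm _ (n : ℝ), Real.exp_nat_mul]
    refine pow_le_pow_left₀ (by positivity) ?_ _
    have := Real.add_one_le_exp (σ * β + σ ^ 2 * β / 2)
    linarith
  have hprod : ∀ i : Fin n → V, ∏ j, w (i j) = (1 + σ) ^ (#{j | i j ∈ B}) := by
    intro i
    have : ∀ j, w (i j) = if i j ∈ B then 1 + σ else 1 := fun j => by
      by_cases h : i j ∈ B <;> simp [hw, h]
    simp_rw [this, prod_ite, prod_const, one_pow, mul_one]
  have hlog : σ * (1 - σ / 2) ≤ Real.log (1 + σ) := by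
    refine le_trans ?_ (Real.le_log_one_add_of_nonneg hσ0)
    rw [le_div_iff₀ (by positivity)]
    nlinarith [pow_nonneg hσ0 3]
  set E : ℝ := (1 + ξ) * β * n * (σ * (1 - σ / 2)) with hE
  have hlow : ∀ ω : WalkSeed V d n, (1 + ξ) * β * n ≤ (#{j | G.walk n ω j ∈ B} : ℝ) →
      Real.exp E ≤ ∏ j, w (G.walk n ω j) := by
    intro ω h
    rw [hprod, ← Real.exp_log (show 0 < 1 + σ by positivity), ← Real.exp_nat_mul]
    refine Real.exp_le_exp.2 ?_
    exact mul_le_mul h hlog (mul_nonneg hσ0 (by linarith)) (Nat.cast_nonneg _)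
  have hmarkov : (#{ω : WalkSeed V d n | (1 + ξ) * β * n ≤ (#{j | G.walk n ω j ∈ B} : ℝ)} : ℝ)
      * Real.exp E ≤ ∑ ω : WalkSeed V d n, ∏ j, w (G.walk n ω j) := by
    rw [← nsmul_eq_mul, ← sum_const]
    refine (sum_le_sum fun ω hω => hlow ω (mem_filter.1 hω).2).trans ?_
    refine sum_le_sum_of_subset_of_nonneg (filter_subset _ _) fun ω _ _ => ?_
    rw [hprod]; positivity
  rw [walkProb_eq, div_le_iff₀ (by rw [hcard]; positivity)]
  have hfin : Real.exp ((σ * β + σ ^ 2 * β / 2) * n) ≤ Real.exp (-(ξ ^ 2 * β * n / 8)) *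
      Real.exp E := by
    rw [← Real.exp_add]
    refine Real.exp_le_exp.2 ?_
    have hβn : 0 ≤ β * n := by positivity
    have : σ + σ ^ 2 / 2 ≤ -(ξ ^ 2 / 8) + (1 + ξ) * (σ * (1 - σ / 2)) := by
      rw [hσ]; nlinarith [mul_nonneg (sq_nonneg ξ) (sub_nonneg.2 hξ1)]
    calc _ = (σ + σ ^ 2 / 2) * (β * n) := by ring
      _ ≤ (-(ξ ^ 2 / 8) + (1 + ξ) * (σ * (1 - σ / 2))) * (β * n) :=
        mul_le_mul_of_nonneg_right this hβn
      _ = _ := by rw [hE]; ring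
  have h1 := hmarkov.trans (hmgf.trans (mul_le_mul_of_nonneg_left hfin (Nat.cast_nonneg _)))
  rw [← mul_assoc] at h1
  have h2 := le_of_mul_le_mul_right h1 (Real.exp_pos E)
  linarith

end RegularGraph

/-! ### Eigenvalues and the contraction of mean-zero functions -/

namespace RegularGraph

variable {V : Type} {d : ℕ} [Fintype V]

section
open Classical in
/-- The coordinate of `g` along the `i`-th eigenvector of the adjacency matrix. -/
noncomputable def eigenCoord (G : RegularGraph V d) (i : V) (g : V → ℝ) : ℝ :=
  ∑ v, G.adjMatrix_isHermitian.eigenvectorBasis i v * g v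

open Classical in
/-- The eigenvalue of the adjacency matrix that belongs to its `i`-th eigenvector. -/
noncomputable def eigenval (G : RegularGraph V d) (i : V) : ℝ :=
  G.adjMatrix_isHermitian.eigenvalues i

theorem sum_eigenCoord_sq (G : RegularGraph V d) (g : V → ℝ) :
    ∑ i, G.eigenCoord i g ^ 2 = ∑ v, g v ^ 2 := by
  classical
  have h := (G.adjMatrix_isHermitian.eigenvectorBasis).sum_sq_norm_inner_right (WithLp.toLp 2 g)
  rw [EuclideanSpace.norm_sq_eq] at h
  simp only [Real.norm_eq_abs, sq_abs] at h
  rw [← h]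
  refine sum_congr rfl fun i _ => ?_
  congr 1
  rw [PiLp.inner_apply]
  exact sum_congr rfl fun v _ => by simp [mul_comm]

theorem eigenCoord_mulVec (G : RegularGraph V d) (i : V) (g : V → ℝ) :
    G.eigenCoord i (G.adjMatrix.mulVec g) = G.eigenval i * G.eigenCoord i g := by
  classical
  have hT : G.adjMatrix.transpose = G.adjMatrix := by
    simpa [Matrix.IsHermitian] using G.adjMatrix_isHermitian
  have h := G.adjMatrix_isHermitian.mulVec_eigenvectorBasis i
  change (G.adjMatrix_isHermitian.eigenvectorBasis i : V → ℝ) ⬝ᵥ G.adjMatrix.mulVec g = _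
  rw [Matrix.dotProduct_mulVec, ← Matrix.mulVec_transpose, hT, h, smul_dotProduct]
  rfl

open Classical in
theorem mulVec_eigenvector (G : RegularGraph V d) (i : V) :
    ∃ x : V → ℝ, G.adjMatrix.mulVec x = G.eigenval i • x ∧
      ∀ j, G.eigenCoord j x = if j = i then 1 else 0 := by
  classical
  refine ⟨_, G.adjMatrix_isHermitian.mulVec_eigenvectorBasis i, fun j => ?_⟩
  have h := (orthonormal_iff_ite.1 G.adjMatrix_isHermitian.eigenvectorBasis.orthonormal) j i
  rw [PiLp.inner_apply] at h
  rw [← h]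
  exact sum_congr rfl fun v _ => by simp [mul_comm]

theorem sum_eq_eigenCoord (G : RegularGraph V d) (f g : V → ℝ) :
    ∑ i, G.eigenCoord i f * G.eigenCoord i g = ∑ v, f v * g v := by
  have h1 := G.sum_eigenCoord_sq (f + g)
  have h2 := G.sum_eigenCoord_sq f
  have h3 := G.sum_eigenCoord_sq g
  have h4 : ∀ i, G.eigenCoord i (f + g) = G.eigenCoord i f + G.eigenCoord i g := by
    intro i; simp [eigenCoord, mul_add, sum_add_distrib]
  simp only [h4, Pi.add_apply, add_sq, sum_add_distrib, mul_assoc, ← mul_sum] at h1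
  linarith

/-- An indexing of the eigenvectors by decreasing eigenvalue, as in the definition of
`RegularGraph.IsExpander`. -/
theorem exists_index (G : RegularGraph V d) :
    ∃ e : Fin (Fintype.card V) ≃ V, Antitone (fun i => G.eigenval (e i)) ∧
      ∀ lam, G.IsExpander lam ↔
        ∀ i : Fin (Fintype.card V), (i : ℕ) ≠ 0 → |G.eigenval (e i)| ≤ lam * d := by
  classical
  have h : ∀ i, G.eigenval ((Fintype.equivOfCardEq (Fintype.card_fin _)) i)
      = G.adjMatrix_isHermitian.eigenvalues₀ i := by
    intro i
    simp [eigenval, Matrix.IsHermitian.eigenvalues]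
  refine ⟨Fintype.equivOfCardEq (Fintype.card_fin _), fun i j hij => ?_, fun lam => ?_⟩
  · simp only [h]; exact G.adjMatrix_isHermitian.eigenvalues₀_antitone hij
  · simp only [h]; rfl
end

theorem mulVec_one (G : RegularGraph V d) :
    G.adjMatrix.mulVec (fun _ => 1) = (d : ℝ) • fun _ => 1 := by
  ext v; simp [adjMatrix_mulVec]

/-- Eigenvectors of an eigenvalue other than `d` are orthogonal to the constants. -/
theorem eigenCoord_one_eq_zero (G : RegularGraph V d) (i : V) (h : G.eigenval i ≠ d) :
    G.eigenCoord i (fun _ => 1) = 0 := by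
  have h1 := G.eigenCoord_mulVec i (fun _ => 1)
  rw [mulVec_one] at h1
  have h2 : G.eigenCoord i ((d : ℝ) • fun _ => 1) = d * G.eigenCoord i (fun _ => 1) := by
    simp [eigenCoord, mul_sum, mul_comm]
  rw [h2] at h1
  have h3 : (G.eigenval i - d) * G.eigenCoord i (fun _ => 1) = 0 := by linarith
  exact (mul_eq_zero.1 h3).resolve_left (sub_ne_zero.2 h)

theorem nrm_avg (G : RegularGraph V d) (g : V → ℝ) :
    nrm (G.avg g) = (d : ℝ)⁻¹ * nrm (G.adjMatrix.mulVec g) := by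
  rw [avg_eq_mulVec, nrm_smul, abs_of_nonneg (inv_nonneg.2 (Nat.cast_nonneg _))]

/-- The eigenvalue condition controls the walk on functions of mean zero: all eigenvalues but the
first differ from `d`, so the constants span the first eigenspace. -/
theorem IsExpander.hasGap {G : RegularGraph V d} {lam : ℝ} (hG : G.IsExpander lam)
    (h0 : 0 ≤ lam) (h1 : lam < 1) : G.HasGap lam := by
  classical
  obtain ⟨e, -, he⟩ := G.exists_index
  have hd := G.degree_cast_pos
  have hlam := (he lam).1 hG
  intro g hg
  have hcoord : ∀ i : Fin (Fintype.card V), (i : ℕ) = 0 → G.eigenCoord (e i) g = 0 := by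
    intro i hi
    have hne : ∀ v, v ≠ e i → G.eigenCoord v (fun _ => 1) = 0 := by
      intro v hv
      refine G.eigenCoord_one_eq_zero v fun hvd => ?_
      have h2 : ((e.symm v : Fin (Fintype.card V)) : ℕ) ≠ 0 := fun h3 => hv <| by
        rw [← e.apply_symm_apply v]; congr 1; exact Fin.ext (h3.trans hi.symm)
      have h3 := hlam _ h2
      rw [e.apply_symm_apply, hvd, abs_of_pos hd] at h3
      nlinarith
    have hp := G.sum_eq_eigenCoord (fun _ => 1) g
    have hq := G.sum_eigenCoord_sq (fun _ => 1)
    rw [sum_eq_single (e i) (fun v _ hv => by rw [hne v hv, zero_mul]) (by simp)] at hp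
    rw [sum_eq_single (e i) (fun v _ hv => by rw [hne v hv]; simp) (by simp)] at hq
    simp only [one_mul, hg] at hp
    refine (mul_eq_zero.1 hp).resolve_left fun h4 => ?_
    have : Nonempty V := ⟨e i⟩
    rw [h4] at hq
    simp only [ne_eq, OfNat.ofNat_ne_zero, not_false_eq_true, zero_pow, one_pow, sum_const,
      card_univ, nsmul_eq_mul, mul_one] at hq
    exact Fintype.card_ne_zero (Nat.cast_eq_zero.1 hq.symm)
  rw [nrm_avg, inv_mul_le_iff₀ hd, ← mul_assoc]
  refine nrm_le_of_sq_le (by positivity) ?_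
  rw [← G.sum_eigenCoord_sq (G.adjMatrix.mulVec g), ← G.sum_eigenCoord_sq g, mul_sum]
  refine sum_le_sum fun v _ => ?_
  rw [eigenCoord_mulVec, mul_pow]
  by_cases hv : ((e.symm v : Fin (Fintype.card V)) : ℕ) = 0
  · have := hcoord _ hv
    rw [e.apply_symm_apply] at this
    simp [this]
  · refine mul_le_mul_of_nonneg_right ?_ (sq_nonneg _)
    have := hlam _ hv
    rw [e.apply_symm_apply] at this
    rw [← sq_abs, mul_comm (d : ℝ)]
    exact pow_le_pow_left₀ (abs_nonneg _) this 2

/-- If the walk shrinks functions of mean zero, then the eigenvalue `d` is simple, hence the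
first one, and every other eigenvector has mean zero. -/
theorem HasGap.isExpander {G : RegularGraph V d} {lam : ℝ} (hG : G.HasGap lam)
    (h1 : lam < 1) : G.IsExpander lam := by
  classical
  obtain ⟨e, hanti, he⟩ := G.exists_index
  have hd := G.degree_cast_pos
  have hgap : ∀ g : V → ℝ, ∑ v, g v = 0 → ∀ c : ℝ, G.adjMatrix.mulVec g = c • g →
      nrm g ≠ 0 → |c| ≤ lam * d := by
    intro g hg c hc hn
    have h2 := hG g hg
    rw [nrm_avg, hc, nrm_smul, inv_mul_le_iff₀ hd] at h2
    have h3 : 0 < nrm g := (nrm_nonneg g).lt_of_ne' hn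
    have h4 : |c| * nrm g ≤ (lam * d) * nrm g := by linarith
    exact le_of_mul_le_mul_right h4 h3
  have hsum : ∀ g : V → ℝ, ∑ i, G.eigenCoord i (fun _ => 1) * G.eigenCoord i g = ∑ v, g v := by
    intro g; rw [sum_eq_eigenCoord]; simp
  have hcase : ∀ i, G.eigenval i ≠ d → |G.eigenval i| ≤ lam * d := by
    intro i hi
    obtain ⟨x, hx, hxc⟩ := G.mulVec_eigenvector i
    have hz : ∑ v, x v = 0 := by
      rw [← hsum]; simp [hxc, G.eigenCoord_one_eq_zero i hi]
    refine hgap x hz _ hx fun h3 => ?_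
    have h4 := nrm_sq x
    rw [h3, ← G.sum_eigenCoord_sq] at h4
    simp [hxc] at h4
  have huniq : ∀ i j, G.eigenval i = d → G.eigenval j = d → i = j := by
    intro i j hi hj
    by_contra hij
    obtain ⟨x, hx, hxc⟩ := G.mulVec_eigenvector i
    obtain ⟨y, hy, hyc⟩ := G.mulVec_eigenvector j
    set s := G.eigenCoord i fun _ => 1 with hs
    set t := G.eigenCoord j fun _ => 1 with ht
    have hsx : ∑ v, x v = s := by rw [← hsum]; simp [hxc, hs]
    have hsy : ∑ v, y v = t := by rw [← hsum]; simp [hyc, ht]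
    -- a combination of the two eigenvectors that has mean zero
    obtain ⟨a, b, hab, h3⟩ : ∃ a b : ℝ, a * s + b * t = 0 ∧ a ^ 2 + b ^ 2 ≠ 0 := by
      by_cases h : s = 0 ∧ t = 0
      · exact ⟨1, 0, by simp [h.1], by norm_num⟩
      · refine ⟨t, -s, by ring, fun h4 => h ⟨?_, ?_⟩⟩ <;> nlinarith [sq_nonneg s, sq_nonneg t]
    have hz : ∑ v, (a • x + b • y) v = 0 := by
      simp only [Pi.add_apply, Pi.smul_apply, smul_eq_mul, sum_add_distrib, ← mul_sum, hsx, hsy,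
        hab]
    have h5 : G.adjMatrix.mulVec (a • x + b • y) = (d : ℝ) • (a • x + b • y) := by
      rw [Matrix.mulVec_add, Matrix.mulVec_smul, Matrix.mulVec_smul, hx, hy, hi, hj]
      module
    have h6 := hgap _ hz _ h5 fun h7 => h3 ?_
    · rw [abs_of_pos hd] at h6
      nlinarith
    · have h8 := nrm_sq (a • x + b • y)
      rw [h7, ← G.sum_eigenCoord_sq] at h8
      have h9 : ∀ v, G.eigenCoord v (a • x + b • y)
          = (if v = i then a else 0) + if v = j then b else 0 := by
        intro v
        have : G.eigenCoord v (a • x + b • y) = a * G.eigenCoord v x + b * G.eigenCoord v y := by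
          simp only [eigenCoord, Pi.add_apply, Pi.smul_apply, smul_eq_mul, mul_sum,
            ← sum_add_distrib]
          exact sum_congr rfl fun _ _ => by ring
        rw [this, hxc, hyc]; simp
      have h10 : ∀ v, G.eigenCoord v (a • x + b • y) ^ 2
          = (if v = i then a ^ 2 else 0) + if v = j then b ^ 2 else 0 := by
        intro v
        rw [h9]
        by_cases h11 : v = i
        · have : v ≠ j := fun h12 => hij (h11.symm.trans h12)
          simp [h11, hij]
        · simp [h11]
      simp_rw [h10, sum_add_distrib] at h8
      simpa using h8.symm
  refine (he lam).2 fun i hi => hcase _ fun hid => ?_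
  have hpos : 0 < Fintype.card V := i.pos
  have h2 := hanti (show (⟨0, hpos⟩ : Fin (Fintype.card V)) ≤ i from Nat.zero_le _)
  simp only [hid] at h2
  by_cases h3 : G.eigenval (e ⟨0, hpos⟩) = d
  · exact hi (congrArg Fin.val (e.injective (huniq _ _ hid h3)))
  · have h4 := (le_abs_self _).trans (hcase _ h3)
    nlinarith

end RegularGraph

/-! ### Random subsets and forced collisions -/

section Sampling

variable {α β : Type*}

/-- The expectation of `f S` for the random subset `S` of `U` that contains each element of `U`
independently with probability `p`. -/
def bernoulliExp (p : ℝ) (U : Finset α) (f : Finset α → ℝ) : ℝ :=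
  ∑ S ∈ U.powerset, p ^ #S * (1 - p) ^ (#U - #S) * f S

theorem bernoulliExp_congr {p : ℝ} {U : Finset α} {f g : Finset α → ℝ}
    (h : ∀ S ⊆ U, f S = g S) : bernoulliExp p U f = bernoulliExp p U g :=
  sum_congr rfl fun S hS => by rw [h S (mem_powerset.1 hS)]

theorem bernoulliExp_mono {p : ℝ} (h0 : 0 ≤ p) (h1 : p ≤ 1) {U : Finset α} {f g : Finset α → ℝ}
    (h : ∀ S ⊆ U, f S ≤ g S) : bernoulliExp p U f ≤ bernoulliExp p U g :=
  sum_le_sum fun S hS => mul_le_mul_of_nonneg_left (h S (mem_powerset.1 hS))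
    (mul_nonneg (pow_nonneg h0 _) (pow_nonneg (sub_nonneg.2 h1) _))

theorem bernoulliExp_add (p : ℝ) (U : Finset α) (f g : Finset α → ℝ) :
    bernoulliExp p U (fun S => f S + g S) = bernoulliExp p U f + bernoulliExp p U g := by
  simp only [bernoulliExp, mul_add, sum_add_distrib]

theorem bernoulliExp_mul (p : ℝ) (U : Finset α) (c : ℝ) (f : Finset α → ℝ) :
    bernoulliExp p U (fun S => c * f S) = c * bernoulliExp p U f := by
  simp only [bernoulliExp, mul_sum]
  exact sum_congr rfl fun _ _ => by ring

theorem bernoulliExp_sum {ι : Type*} (p : ℝ) (U : Finset α) (s : Finset ι)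
    (f : ι → Finset α → ℝ) :
    bernoulliExp p U (fun S => ∑ i ∈ s, f i S) = ∑ i ∈ s, bernoulliExp p U (f i) := by
  simp only [bernoulliExp, mul_sum]
  exact sum_comm

variable [DecidableEq α]

theorem bernoulliExp_insert (p : ℝ) {U : Finset α} {u : α} (hu : u ∉ U) (f : Finset α → ℝ) :
    bernoulliExp p (insert u U) f
      = (1 - p) * bernoulliExp p U f + p * bernoulliExp p U (fun S => f (insert u S)) := by
  rw [bernoulliExp, sum_powerset_insert hu, bernoulliExp, bernoulliExp, mul_sum, mul_sum]
  congr 1 <;> refine sum_congr rfl fun S hS => ?_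
  · have h := card_le_card (mem_powerset.1 hS)
    rw [card_insert_of_notMem hu, Nat.succ_sub h, pow_succ]
    ring
  · have hS' : u ∉ S := fun h => hu (mem_powerset.1 hS h)
    rw [card_insert_of_notMem hu, card_insert_of_notMem hS', Nat.succ_sub_succ, pow_succ]
    ring

theorem bernoulliExp_const (p : ℝ) (U : Finset α) (c : ℝ) :
    bernoulliExp p U (fun _ => c) = c := by
  induction U using Finset.induction_on with
  | empty => simp [bernoulliExp]
  | insert u U hu ih => rw [bernoulliExp_insert p hu, ih]; ring

theorem bernoulliExp_card (p : ℝ) (U : Finset α) :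
    bernoulliExp p U (fun S => (#S : ℝ)) = p * #U := by
  induction U using Finset.induction_on with
  | empty => simp [bernoulliExp]
  | insert u U hu ih =>
    rw [bernoulliExp_insert p hu, ih, bernoulliExp_congr (g := fun S => (#S : ℝ) + 1),
      bernoulliExp_add, bernoulliExp_const, ih, card_insert_of_notMem hu]
    · push_cast; ring
    · intro S hS
      rw [card_insert_of_notMem fun h => hu (hS h)]; push_cast; rfl

theorem bernoulliExp_card_mul_card_sub_one (p : ℝ) (U : Finset α) :
    bernoulliExp p U (fun S => (#S : ℝ) * (#S - 1)) = p ^ 2 * (#U * (#U - 1)) := by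
  induction U using Finset.induction_on with
  | empty => simp [bernoulliExp]
  | insert u U hu ih =>
    rw [bernoulliExp_insert p hu, ih,
      bernoulliExp_congr (g := fun S => (#S : ℝ) * (#S - 1) + 2 * #S),
      bernoulliExp_add, bernoulliExp_mul, ih, bernoulliExp_card, card_insert_of_notMem hu]
    · push_cast; ring
    · intro S hS
      rw [card_insert_of_notMem fun h => hu (hS h)]; push_cast; ring

open Classical in
/-- If `g` is injective on `S` and misses `g r`, then adding `r` to `S` keeps `g` injective. So,
given that `g` is injective on the random set, it misses `g r` with probability at most `1 - p`. -/
theorem bernoulliExp_injOn_avoid_le {p : ℝ} (h0 : 0 ≤ p) (h1 : p ≤ 1) (U : Finset α) (g : α → β)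
    {r : α} (hr : r ∈ U) :
    bernoulliExp p U (fun S => if Set.InjOn g S ∧ g r ∉ S.image g then 1 else 0)
      ≤ (1 - p) * bernoulliExp p U (fun S => if Set.InjOn g S then 1 else 0) := by
  obtain ⟨U, hrU, rfl⟩ : ∃ U', r ∉ U' ∧ insert r U' = U :=
    ⟨U.erase r, notMem_erase r U, insert_erase hr⟩
  rw [bernoulliExp_insert p hrU, bernoulliExp_insert p hrU]
  have e1 : bernoulliExp p U (fun S => if Set.InjOn g (insert r S : Finset α) ∧
      g r ∉ (insert r S).image g then 1 else 0) = 0 := by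
    rw [bernoulliExp_congr (g := fun _ => 0), bernoulliExp_const]
    intro S _
    rw [if_neg]
    rintro ⟨-, h⟩
    exact h (mem_image_of_mem _ (mem_insert_self _ _))
  have e2 : bernoulliExp p U (fun S => if Set.InjOn g S ∧ g r ∉ S.image g then 1 else 0)
      ≤ bernoulliExp p U (fun S => if Set.InjOn g (insert r S : Finset α) then 1 else 0) := by
    refine bernoulliExp_mono h0 h1 fun S hS => ?_
    split_ifs with h2 h3 h3
    · rfl
    · refine absurd ?_ h3
      rw [coe_insert, Set.injOn_insert (fun h => hrU (hS h))]
      exact ⟨h2.1, by simpa using h2.2⟩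
    · exact zero_le_one
    · rfl
  have e3 : bernoulliExp p U (fun S => if Set.InjOn g S ∧ g r ∉ S.image g then 1 else 0)
      ≤ bernoulliExp p U (fun S => if Set.InjOn g S then 1 else 0) := by
    refine bernoulliExp_mono h0 h1 fun S _ => ?_
    split_ifs with h2 h3 h3
    · rfl
    · exact absurd h2.1 h3
    · exact zero_le_one
    · rfl
  rw [e1]
  have h4 := mul_le_mul_of_nonneg_left e3 (sub_nonneg.2 h1)
  have h5 := mul_le_mul_of_nonneg_left e2 h0
  refine le_trans (le_of_eq ?_) (mul_le_mul_of_nonneg_left (add_le_add h4 h5) (sub_nonneg.2 h1))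
  ring

open Classical in
/-- A birthday bound: if `g` takes few values on `U`, then it is unlikely to be injective on a
random subset of `U`. -/
theorem bernoulliExp_injOn_le {p : ℝ} (h0 : 0 ≤ p) (h1 : p ≤ 1) (U : Finset α) (g : α → β) :
    bernoulliExp p U (fun S => if Set.InjOn g S then 1 else 0)
      ≤ (1 - p ^ 2) ^ (#U - #(U.image g)) := by
  have hp2 : 0 ≤ 1 - p ^ 2 := by nlinarith
  induction U using Finset.induction_on with
  | empty => simp [bernoulliExp]
  | insert u U hu ih =>
    rw [bernoulliExp_insert p hu, card_insert_of_notMem hu, image_insert]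
    have hins : bernoulliExp p U (fun S => if Set.InjOn g (insert u S : Finset α) then 1 else 0)
        = bernoulliExp p U (fun S => if Set.InjOn g S ∧ g u ∉ S.image g then 1 else 0) := by
      refine bernoulliExp_congr fun S hS => ?_
      congr 1
      rw [coe_insert, Set.injOn_insert (fun h => hu (hS h))]
      simp
    rw [hins]
    by_cases h : g u ∈ U.image g
    · obtain ⟨r, hr, hru⟩ := mem_image.1 h
      rw [insert_eq_of_mem h, Nat.succ_sub card_image_le, pow_succ]
      have h2 := bernoulliExp_injOn_avoid_le h0 h1 U g hr
      rw [hru] at h2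
      have h3 := mul_le_mul_of_nonneg_left h2 h0
      have h4 := mul_le_mul_of_nonneg_right ih hp2
      refine le_trans ?_ h4
      nlinarith
    · rw [card_insert_of_notMem h, Nat.succ_sub_succ]
      refine le_trans ?_ ih
      have h2 : bernoulliExp p U (fun S => if Set.InjOn g S ∧ g u ∉ S.image g then 1 else 0)
          = bernoulliExp p U (fun S => if Set.InjOn g S then 1 else 0) := by
        refine bernoulliExp_congr fun S hS => ?_
        congr 1
        exact propext (and_iff_left fun h3 => h (image_subset_image hS h3))
      rw [h2]
      exact le_of_eq (by ring)

end Sampling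

section Collisions

variable {V F : Type}

open Classical in
/-- The number of positions `j` at which two distinct words of `T` agree in the coordinate
`i j`. -/
noncomputable def collisionCount {n : ℕ} (T : Finset (V → F)) (i : Fin n → V) : ℕ :=
  #{j | ¬ Set.InjOn (fun u : V → F => u (i j)) T}

/-- If at every position the words of `U` take at most `k` values, where `k` is noticeably
smaller than the number of words, then some subset `S` of `U` has more collisions than
`θ * (#S choose 2)`, the expected number when any two words agree on a fraction `θ` of the
coordinates. -/
theorem exists_collisionCount_ge {n : ℕ} (hn : 0 < n) (U : Finset (V → F)) (i : Fin n → V)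
    (k : ℕ) (hk : k < #U) {ξ θ : ℝ} (hξ0 : 0 < ξ) (hξ : ξ ≤ 1 / 4)
    (hU : ∀ j, ((fun u : V → F => u (i j)) '' U).ncard ≤ k)
    (hL : (#U : ℝ) * (#U - 1) / 2 * θ * (1 + 3 * ξ) ≤ #U - k) :
    ∃ S ⊆ U, S.Nonempty ∧
      (1 + ξ) * ((#S : ℝ) * (#S - 1) / 2 * θ + ξ ^ 2 / 8) * n ≤ collisionCount S i := by
  classical
  by_contra! hcon
  set N : ℕ := #U - k with hN
  have hN1 : 1 ≤ N := by omega
  have hN1' : (1 : ℝ) ≤ N := by exact_mod_cast hN1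
  have hNr : (N : ℝ) = #U - k := by rw [hN, Nat.cast_sub hk.le]
  -- the sampling rate for which the expected number of collisions per position is about `ξ`
  set p : ℝ := √(ξ / N) with hp
  have hp2 : p ^ 2 = ξ / N := Real.sq_sqrt (by positivity)
  have hp0 : 0 ≤ p := Real.sqrt_nonneg _
  have hp1 : p ≤ 1 := by
    rw [hp, Real.sqrt_le_one, div_le_one (by positivity)]
    linarith
  have hn' : (0 : ℝ) < n := Nat.cast_pos.2 hn
  have hupper : bernoulliExp p U (fun S => (collisionCount S i : ℝ))
      ≤ (1 + ξ) * (p ^ 2 * ((#U : ℝ) * (#U - 1)) / 2 * θ + ξ ^ 2 / 8) * n := by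
    refine (bernoulliExp_mono hp0 hp1 (g := fun S =>
      ((1 + ξ) * θ * n / 2) * ((#S : ℝ) * (#S - 1)) + (1 + ξ) * (ξ ^ 2 / 8) * n)
      fun S hS => ?_).trans (le_of_eq ?_)
    · rcases S.eq_empty_or_nonempty with rfl | hne
      · simp [collisionCount]; positivity
      · refine (hcon S hS hne).le.trans (le_of_eq ?_)
        ring
    · rw [bernoulliExp_add, bernoulliExp_mul, bernoulliExp_const,
        bernoulliExp_card_mul_card_sub_one]
      ring
  have hpow : (1 - p ^ 2) ^ N ≤ 1 / (1 + ξ) := by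
    have h1 : 1 + ξ ≤ (1 + p ^ 2) ^ N := by
      have := one_add_mul_le_pow (a := p ^ 2) (by nlinarith [sq_nonneg p]) N
      rwa [hp2, mul_div_cancel₀ _ (by positivity), ← hp2] at this
    have h2 : (1 - p ^ 2) ^ N * (1 + p ^ 2) ^ N ≤ 1 := by
      rw [← mul_pow]
      have h3 : p ^ 2 ≤ 1 := pow_le_one₀ hp0 hp1
      refine pow_le_one₀ (mul_nonneg (by linarith) (by positivity)) ?_
      nlinarith [sq_nonneg (p ^ 2)]
    rw [le_div_iff₀ (by positivity)]
    refine (mul_le_mul_of_nonneg_left h1 (pow_nonneg (by nlinarith) _)).trans h2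
  have hlower : n * (1 - 1 / (1 + ξ)) ≤ bernoulliExp p U (fun S => (collisionCount S i : ℝ)) := by
    have e : ∀ S : Finset (V → F), (collisionCount S i : ℝ)
        = ∑ j : Fin n, (1 + (-1) * if Set.InjOn (fun u : V → F => u (i j)) S then 1 else 0) := by
      intro S
      rw [collisionCount, card_filter]
      push_cast
      refine sum_congr rfl fun j _ => ?_
      split_ifs <;> norm_num
    simp_rw [e]
    rw [bernoulliExp_sum]
    have : (n : ℝ) * (1 - 1 / (1 + ξ)) = ∑ _j : Fin n, (1 - 1 / (1 + ξ)) := by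
      rw [sum_const, card_univ, Fintype.card_fin, nsmul_eq_mul]
    rw [this]
    refine sum_le_sum fun j _ => ?_
    rw [bernoulliExp_add, bernoulliExp_const, bernoulliExp_mul]
    have h1 := bernoulliExp_injOn_le hp0 hp1 U (fun u : V → F => u (i j))
    have h2 : N ≤ #U - #(U.image fun u : V → F => u (i j)) := by
      have := hU j
      rw [← coe_image, Set.ncard_coe_finset] at this
      omega
    have h3 := pow_le_pow_of_le_one (by nlinarith : 0 ≤ 1 - p ^ 2)
      (by nlinarith [sq_nonneg p]) h2
    linarith
  have h1 : (1 - 1 / (1 + ξ)) ≤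
      (1 + ξ) * (p ^ 2 * ((#U : ℝ) * (#U - 1)) / 2 * θ + ξ ^ 2 / 8) := by
    have := hlower.trans hupper
    rw [mul_comm] at this
    exact le_of_mul_le_mul_right this hn'
  have h2 : p ^ 2 * ((#U : ℝ) * (#U - 1)) / 2 * θ ≤ ξ / (1 + 3 * ξ) := by
    rw [le_div_iff₀ (by positivity), hp2]
    rw [← hNr] at hL
    calc _ = ξ / N * ((#U : ℝ) * (#U - 1) / 2 * θ * (1 + 3 * ξ)) := by ring
      _ ≤ ξ / N * N := mul_le_mul_of_nonneg_left hL (by positivity)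
      _ = ξ := by field_simp
  have h3 : (1 + ξ) * (ξ / (1 + 3 * ξ) + ξ ^ 2 / 8) < 1 - 1 / (1 + ξ) := by
    have : (1 + ξ) * (ξ / (1 + 3 * ξ) + ξ ^ 2 / 8) - (1 - 1 / (1 + ξ))
        = -(ξ ^ 2 * (7 - 13 * ξ - 7 * ξ ^ 2 - 3 * ξ ^ 3)) / (8 * (1 + 3 * ξ) * (1 + ξ)) := by
      field_simp
      ring
    have h4 : 0 < 7 - 13 * ξ - 7 * ξ ^ 2 - 3 * ξ ^ 3 := by
      nlinarith [mul_nonneg hξ0.le (sub_nonneg.2 hξ), pow_pos hξ0 2,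
        mul_nonneg (pow_pos hξ0 2).le (sub_nonneg.2 hξ)]
    have h5 : -(ξ ^ 2 * (7 - 13 * ξ - 7 * ξ ^ 2 - 3 * ξ ^ 3)) / (8 * (1 + 3 * ξ) * (1 + ξ)) < 0 :=
      div_neg_of_neg_of_pos (neg_neg_of_pos (by positivity)) (by positivity)
    linarith
  have h4 := mul_le_mul_of_nonneg_left (add_le_add_left h2 (ξ ^ 2 / 8))
    (by positivity : 0 ≤ 1 + ξ)
  linarith

end Collisions

/-! ### Good puncturings: consequences and probability -/

section FewCollisions

variable {V F : Type}

/-- The good event for a puncturing `i` of the code `D`: no set `T` of codewords has noticeably more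
collisions than one expects if any two codewords agree on a fraction `θ` of the coordinates. The
additive slack `ξ ^ 2 / 8` takes care of small sets `T`. -/
def FewCollisions {n : ℕ} (D : Finset (V → F)) (θ ξ : ℝ) (i : Fin n → V) : Prop :=
  ∀ T ⊆ D, T.Nonempty →
    (collisionCount T i : ℝ) < (1 + ξ) * ((#T : ℝ) * (#T - 1) / 2 * θ + ξ ^ 2 / 8) * n

theorem FewCollisions.injOn {n : ℕ} {D : Finset (V → F)} {θ ξ : ℝ} {i : Fin n → V}
    (h : FewCollisions D θ ξ i) (hξ0 : 0 ≤ ξ) (hξ : ξ ≤ 1 / 4) (hθ : θ ≤ 1 / 2) :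
    Set.InjOn (fun (u : V → F) (j : Fin n) => u (i j)) D := by
  classical
  intro u hu w hw huw
  by_contra hne
  have h1 := h {u, w} (by
    intro x hx
    rcases mem_insert.1 hx with rfl | hx
    · exact hu
    · rw [mem_singleton.1 hx]; exact hw) ⟨u, mem_insert_self _ _⟩
  have h2 : collisionCount {u, w} i = n := by
    rw [collisionCount, filter_true_of_mem, card_univ, Fintype.card_fin]
    intro j _ hinj
    exact hne (hinj (by simp) (by simp) (congrFun huw j))
  rw [h2, card_pair hne] at h1
  have h3 : (1 + ξ) * ((2 : ℝ) * (2 - 1) / 2 * θ + ξ ^ 2 / 8) ≤ 1 := by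
    nlinarith [mul_le_mul_of_nonneg_left hθ hξ0, mul_nonneg hξ0 (sub_nonneg.2 hξ), sq_nonneg ξ,
      mul_nonneg (sq_nonneg ξ) (sub_nonneg.2 hξ)]
  have h4 := mul_le_mul_of_nonneg_right h3 (Nat.cast_nonneg (α := ℝ) n)
  push_cast at h1
  linarith

theorem FewCollisions.zeroErrorListRecoverable {n : ℕ} (hn : 0 < n) {D : Finset (V → F)}
    {θ ξ : ℝ} {i : Fin n → V} (h : FewCollisions D θ ξ i) (hξ0 : 0 < ξ) (hξ : ξ ≤ 1 / 4)
    {ℓ M : ℝ} (hM : 0 ≤ ℓ → ℓ ≤ M)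
    (hL : 0 ≤ ℓ → ∀ L : ℝ, 1 ≤ L → M < L → L ≤ M + 1 →
      L * (L - 1) / 2 * θ * (1 + 3 * ξ) ≤ L - ℓ) :
    ZeroErrorListRecoverable (puncturedCode (D : Set (V → F)) i) ℓ M := by
  classical
  intro A hA
  have hℓ : 0 ≤ ℓ := (Nat.cast_nonneg _).trans (hA ⟨0, hn⟩)
  have hM0 : 0 ≤ M := hℓ.trans (hM hℓ)
  by_contra! hlt
  set Y : Finset (V → F) := {u ∈ D | ∀ j, u (i j) ∈ A j} with hY
  have hX : {c ∈ puncturedCode (D : Set (V → F)) i | ∀ j, c j ∈ A j}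
      ⊆ (fun (u : V → F) (j : Fin n) => u (i j)) '' Y := by
    rintro c ⟨⟨u, hu, rfl⟩, hc⟩
    exact ⟨u, by simpa [hY] using ⟨hu, hc⟩, rfl⟩
  have hcard : {c ∈ puncturedCode (D : Set (V → F)) i | ∀ j, c j ∈ A j}.ncard ≤ #Y :=
    (Set.ncard_le_ncard hX (Y.finite_toSet.image _)).trans
      ((Set.ncard_image_le Y.finite_toSet).trans (Set.ncard_coe_finset Y).le)
  have hYM : ⌊M⌋₊ + 1 ≤ #Y := by
    have : M < #Y := hlt.trans_le (by exact_mod_cast hcard)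
    exact Nat.succ_le_of_lt ((Nat.floor_lt hM0).2 this)
  obtain ⟨U, hUY, hU⟩ := exists_subset_card_eq hYM
  have hUr : (#U : ℝ) = ⌊M⌋₊ + 1 := by rw [hU]; push_cast; rfl
  have hkM : ⌊ℓ⌋₊ ≤ ⌊M⌋₊ := Nat.floor_le_floor (hM hℓ)
  obtain ⟨S, hSU, hS, hcol⟩ := exists_collisionCount_ge hn U i ⌊ℓ⌋₊ (by omega) hξ0 hξ (θ := θ)
    (fun j => by
      have h1 : (fun u : V → F => u (i j)) '' U ⊆ A j := by
        rintro _ ⟨u, hu, rfl⟩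
        exact (mem_filter.1 (hUY hu)).2 j
      refine (Set.ncard_le_ncard h1 (A j).finite_toSet).trans ?_
      rw [Set.ncard_coe_finset]
      exact Nat.le_floor (hA j))
    (by
      have h1 := hL hℓ #U (by rw [hUr]; linarith [Nat.cast_nonneg (α := ℝ) ⌊M⌋₊])
        (by rw [hUr]; exact Nat.lt_floor_add_one M)
        (by rw [hUr]; linarith [Nat.floor_le hM0])
      have h2 := Nat.floor_le hℓ
      linarith)
  exact absurd (h S (hSU.trans (hUY.trans (filter_subset _ _))) hS) (not_lt.2 hcol)

end FewCollisions

section Probability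

variable {V F : Type} {d : ℕ} [Fintype V]

open Classical in
/-- The coordinates in which two distinct words of `T` agree are at most `θ (#T choose 2)` of all,
if any two words agree on a fraction `θ` of the coordinates. -/
theorem card_collision_le (T : Finset (V → F)) {θ : ℝ}
    (hT : ∀ u ∈ T, ∀ w ∈ T, u ≠ w → (#{v | u v = w v} : ℝ) ≤ θ * Fintype.card V) :
    (#{v : V | ¬ Set.InjOn (fun u : V → F => u v) T} : ℝ)
      ≤ ((#T : ℝ) * (#T - 1) / 2 * θ) * Fintype.card V := by
  have h1 : 2 * #{v : V | ¬ Set.InjOn (fun u : V → F => u v) T}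
      ≤ ∑ v, #{x ∈ T.offDiag | x.1 v = x.2 v} := by
    rw [mul_comm, ← smul_eq_mul, ← sum_const]
    refine le_trans (sum_le_sum (g := fun v => #{x ∈ T.offDiag | x.1 v = x.2 v})
      fun v hv => ?_) (sum_le_sum_of_subset (subset_univ _))
    have h2 : ¬ Set.InjOn (fun u : V → F => u v) T := (mem_filter.1 hv).2
    simp only [Set.InjOn, not_forall] at h2
    obtain ⟨a, ha, b, hb, hab, hne⟩ := h2
    refine one_lt_card.2 ⟨(a, b), ?_, (b, a), ?_, fun h => hne (congrArg Prod.fst h)⟩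
    · exact mem_filter.2 ⟨mem_offDiag.2 ⟨ha, hb, hne⟩, hab⟩
    · exact mem_filter.2 ⟨mem_offDiag.2 ⟨hb, ha, Ne.symm hne⟩, hab.symm⟩
  have h2 : ∑ v, #{x ∈ T.offDiag | x.1 v = x.2 v} = ∑ x ∈ T.offDiag, #{v | x.1 v = x.2 v} := by
    simp only [card_filter]; exact sum_comm
  have h3 : ((∑ x ∈ T.offDiag, #{v | x.1 v = x.2 v} : ℕ) : ℝ)
      ≤ #T.offDiag * (θ * Fintype.card V) := by
    rw [← nsmul_eq_mul, ← sum_const]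
    push_cast
    refine sum_le_sum fun x hx => ?_
    obtain ⟨ha, hb, hne⟩ := mem_offDiag.1 hx
    exact hT _ ha _ hb hne
  have h4 : (#T.offDiag : ℝ) = #T * (#T - 1) := by
    rw [offDiag_card, Nat.cast_sub (Nat.le_mul_self _)]; push_cast; ring
  rw [← h2, h4] at h3
  have h5 : (2 * #{v : V | ¬ Set.InjOn (fun u : V → F => u v) T} : ℝ)
      ≤ (∑ v, #{x ∈ T.offDiag | x.1 v = x.2 v} : ℕ) := by exact_mod_cast h1
  linarith

namespace RegularGraph

theorem walkProb_mono (G : RegularGraph V d) {n : ℕ} {P Q : (Fin n → V) → Prop}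
    (h : ∀ i, P i → Q i) : G.walkProb n P ≤ G.walkProb n Q := by
  classical
  rw [walkProb_eq, walkProb_eq]
  gcongr
  exact h _

/-- The union bound. -/
theorem one_sub_sum_le_walkProb (G : RegularGraph V d) [Nonempty V] {ι : Type*} (s : Finset ι)
    {n : ℕ} (P : ι → (Fin n → V) → Prop) :
    1 - ∑ T ∈ s, G.walkProb n (P T) ≤ G.walkProb n (fun i => ∀ T ∈ s, ¬ P T i) := by
  classical
  have hd := G.degree_pos
  have : Nonempty (Fin d) := ⟨⟨0, hd⟩⟩
  have hpos : (0 : ℝ) < Fintype.card (WalkSeed V d n) := Nat.cast_pos.2 Fintype.card_pos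
  simp only [walkProb_eq]
  rw [← sum_div, sub_le_iff_le_add, ← add_div, le_div_iff₀ hpos, one_mul]
  have hsub : (univ : Finset (WalkSeed V d n)) ⊆
      ({ω | ∀ T ∈ s, ¬ P T (G.walk n ω)} : Finset (WalkSeed V d n)) ∪
        s.biUnion fun T => {ω | P T (G.walk n ω)} := by
    intro ω _
    by_cases h : ∀ T ∈ s, ¬ P T (G.walk n ω)
    · exact mem_union_left _ (mem_filter.2 ⟨mem_univ _, h⟩)
    · push Not at h
      obtain ⟨T, hT, hP⟩ := h
      exact mem_union_right _ (mem_biUnion.2 ⟨T, hT, mem_filter.2 ⟨mem_univ _, hP⟩⟩)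
  have h1 := (card_le_card hsub).trans ((card_union_le _ _).trans
    (Nat.add_le_add_left card_biUnion_le _))
  rw [card_univ] at h1
  exact_mod_cast h1

end RegularGraph

/-- Weights `x ≤ N⁻²` per element have total weight at most `1` on the nonempty subsets of a set
with `N ≥ 2` elements. -/
theorem sum_nonempty_subsets_le {α : Type*} [DecidableEq α] (D : Finset α) (hD : 2 ≤ #D) {x : ℝ}
    (hx0 : 0 ≤ x) (hx : x * (#D : ℝ) ^ 2 ≤ 1) : ∑ T ∈ D.powerset.erase ∅, x ^ #T ≤ 1 := by
  have hD' : (2 : ℝ) ≤ #D := by exact_mod_cast hD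
  have h1 : ∑ T ∈ D.powerset, x ^ #T = (x + 1) ^ #D := by
    rw [← sum_pow_mul_eq_add_pow]; simp
  have h2 := add_sum_erase D.powerset (fun T => x ^ #T) (empty_mem_powerset D)
  simp only [card_empty, pow_zero] at h2
  have h3 : (x + 1) ^ #D ≤ Real.exp (1 / 2) := by
    refine (pow_le_pow_left₀ (by positivity) (Real.add_one_le_exp x) _).trans ?_
    rw [← Real.exp_nat_mul]
    refine Real.exp_le_exp.2 ?_
    nlinarith [mul_nonneg hx0 (by linarith : (0 : ℝ) ≤ #D)]
  have h4 : Real.exp (1 / 2) ≤ 2 := by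
    have h5 : Real.exp (1 / 2) ^ 2 = Real.exp 1 := by
      rw [← Real.exp_nat_mul]; norm_num
    nlinarith [Real.exp_one_lt_d9, Real.exp_pos (1 / 2)]
  linarith

open Classical in
/-- A random walk on an expander has few collisions with high probability. The union bound runs
over all sets `T` of codewords: a set of size `s` is bad with probability exponentially small in
`(s² θ + ξ²) n ≳ s √θ n`, which beats the `|D|ˢ` choices of `T` once `n ≳ log |D| / √θ`. -/
theorem RegularGraph.walkProb_fewCollisions_ge (G : RegularGraph V d) (hG : G.HasGap (1 / 4))
    [Nonempty V] (D : Finset (V → F)) (hD : 2 ≤ #D) {θ ξ ε K : ℝ} {n : ℕ}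
    (hξ0 : 0 < ξ) (hξ : ξ ≤ 1 / 4) (hε0 : 0 < ε) (hε : ε ≤ 1) (hθ : ε ^ 2 / 4 ≤ θ)
    (hagree : ∀ u ∈ D, ∀ w ∈ D, u ≠ w → (#{v | u v = w v} : ℝ) ≤ θ * Fintype.card V)
    (hK : 256 / ξ ^ 4 ≤ K) (hn : K * Real.log #D ≤ ε * n) :
    1 - Real.exp (-(ξ ^ 4 / 128) * n) ≤ G.walkProb n (FewCollisions D θ ξ) := by
  have hD' : (2 : ℝ) ≤ #D := by exact_mod_cast hD
  have hlog : 0 < Real.log #D := Real.log_pos (by linarith)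
  have hKpos : 0 < K := lt_of_lt_of_le (by positivity) hK
  have hn0 : 0 < n := by
    rcases Nat.eq_zero_or_pos n with rfl | h
    · have := mul_pos hKpos hlog
      simp at hn; linarith
    · exact h
  have hn' : (0 : ℝ) < n := Nat.cast_pos.2 hn0
  have hθ0 : 0 ≤ θ := le_trans (by positivity) hθ
  set x : ℝ := Real.exp (-(2 * Real.log #D)) with hx
  have hxD : x * (#D : ℝ) ^ 2 ≤ 1 := by
    have h2 : (#D : ℝ) ^ 2 = Real.exp (2 * Real.log #D) := by
      rw [two_mul, Real.exp_add, Real.exp_log (by linarith), sq]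
    rw [hx, h2, ← Real.exp_add, neg_add_cancel, Real.exp_zero]
  set bad : Finset (V → F) → (Fin n → V) → Prop := fun T i =>
    (1 + ξ) * ((#T : ℝ) * (#T - 1) / 2 * θ + ξ ^ 2 / 8) * n ≤ (collisionCount T i : ℝ) with hbad
  have hone : ∀ T ∈ D.powerset.erase ∅,
      G.walkProb n (bad T) ≤ Real.exp (-(ξ ^ 4 / 128) * n) * x ^ #T := by
    intro T hT
    obtain ⟨hTne, hTD⟩ := mem_erase.1 hT
    have hTD := mem_powerset.1 hTD
    have hs1 : (1 : ℝ) ≤ #T := by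
      exact_mod_cast card_pos.2 (nonempty_iff_ne_empty.2 hTne)
    set s : ℝ := (#T : ℝ) with hs
    set β : ℝ := s * (s - 1) / 2 * θ + ξ ^ 2 / 8 with hβ
    have hss : 0 ≤ s * (s - 1) / 2 := by
      have := mul_nonneg (by linarith : 0 ≤ s) (sub_nonneg.2 hs1)
      linarith
    have hβ0 : 0 ≤ β := by positivity
    have hB : (#{v : V | ¬ Set.InjOn (fun u : V → F => u v) T} : ℝ) ≤ β * Fintype.card V := by
      refine (card_collision_le T fun u hu w hw => hagree u (hTD hu) w (hTD hw)).trans ?_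
      refine mul_le_mul_of_nonneg_right ?_ (Nat.cast_nonneg _)
      rw [hβ]; nlinarith [sq_nonneg ξ]
    have h1 := G.walkProb_visits_le hG _ hξ0.le (by linarith) hβ0 hB hn0
    have h2 : G.walkProb n (bad T) ≤ Real.exp (-(ξ ^ 2 * β * n / 8)) := by
      refine le_trans (le_of_eq ?_) h1
      congr 1
      ext i
      have h3 : collisionCount T i
          = #{j | i j ∈ ({v : V | ¬ Set.InjOn (fun u : V → F => u v) T} : Finset V)} := by
        simp only [collisionCount, mem_filter, mem_univ, true_and]
      rw [← h3]
    refine h2.trans ?_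
    rw [hx, ← Real.exp_nat_mul, ← Real.exp_add]
    refine Real.exp_le_exp.2 ?_
    -- half of the exponent pays for the number of sets of size `s`
    have h3 : ξ ^ 2 / 8 * s * ε ≤ β := by
      rcases eq_or_ne (#T) 1 with h | h
      · have : s = 1 := by rw [hs, h]; simp
        rw [hβ, this]; nlinarith [sq_nonneg ξ]
      · have hs2 : 2 ≤ s := by
          have : 2 ≤ #T := by
            have := card_pos.2 (nonempty_iff_ne_empty.2 hTne)
            omega
          rw [hs]; exact_mod_cast this
        have h4 : s ^ 2 / 4 * (ε ^ 2 / 4) ≤ s * (s - 1) / 2 * θ :=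
          mul_le_mul (by nlinarith) hθ (by positivity) hss
        have h5 : ξ ^ 2 / 8 ≤ 1 / 128 := by nlinarith
        have h6 : 0 ≤ s * ε := by positivity
        have h7 : 0 ≤ ξ ^ 2 / 8 := by positivity
        set δ := ξ ^ 2 / 8
        rw [hβ]
        nlinarith [sq_nonneg (s * ε - 2), mul_nonneg h7 (sq_nonneg (s * ε - 2)),
          mul_nonneg (sub_nonneg.2 h5) (sq_nonneg (s * ε))]
    have h4 : 2 * s * Real.log #D ≤ ξ ^ 2 * β * n / 16 := by
      have h5 : 256 ≤ ξ ^ 4 * K := by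
        rw [div_le_iff₀ (by positivity)] at hK; linarith
      have h6 : 256 * Real.log #D ≤ ξ ^ 4 * (ε * n) := by
        calc 256 * Real.log #D ≤ ξ ^ 4 * K * Real.log #D :=
              mul_le_mul_of_nonneg_right h5 hlog.le
          _ = ξ ^ 4 * (K * Real.log #D) := by ring
          _ ≤ _ := mul_le_mul_of_nonneg_left hn (by positivity)
      calc 2 * s * Real.log #D = s / 128 * (256 * Real.log #D) := by ring
        _ ≤ s / 128 * (ξ ^ 4 * (ε * n)) := mul_le_mul_of_nonneg_left h6 (by positivity)
        _ = ξ ^ 2 * n / 16 * (ξ ^ 2 / 8 * s * ε) := by ring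
        _ ≤ ξ ^ 2 * n / 16 * β := mul_le_mul_of_nonneg_left h3 (by positivity)
        _ = _ := by ring
    have h5 : ξ ^ 4 / 128 * n ≤ ξ ^ 2 * β * n / 16 := by
      have : ξ ^ 2 / 8 ≤ β := by rw [hβ]; nlinarith
      calc _ = ξ ^ 2 * n / 16 * (ξ ^ 2 / 8) := by ring
        _ ≤ ξ ^ 2 * n / 16 * β := mul_le_mul_of_nonneg_left this (by positivity)
        _ = _ := by ring
    linarith
  have hsum : ∑ T ∈ D.powerset.erase ∅, G.walkProb n (bad T)
      ≤ Real.exp (-(ξ ^ 4 / 128) * n) := by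
    refine (sum_le_sum hone).trans ?_
    rw [← mul_sum]
    exact mul_le_of_le_one_right (Real.exp_pos _).le
      (sum_nonempty_subsets_le D hD (Real.exp_pos _).le hxD)
  refine (sub_le_sub_left hsum 1).trans ((G.one_sub_sum_le_walkProb _ bad).trans ?_)
  refine G.walkProb_mono fun i hi T hTD hT => not_le.1 (hi T ?_)
  exact mem_erase.2 ⟨hT.ne_empty, mem_powerset.2 hTD⟩

end Probability

/-! ### Labelled graphs and the zig-zag product -/

/-- A regular undirected multigraph whose edge labels act as permutations of the vertices: the edge
with label `a` leads from `v` to `step a v`, and its reverse has label `inv a`. -/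
structure LabelledGraph (V D : Type) where
  step : D → Equiv.Perm V
  inv : D → D
  inv_inv : ∀ a, inv (inv a) = a
  step_inv : ∀ a, step (inv a) = (step a)⁻¹

theorem nrm_comp_perm {V : Type} [Fintype V] (f : V → ℝ) (e : Equiv.Perm V) :
    nrm (fun v => f (e v)) = nrm f := by
  rw [nrm, nrm, Equiv.sum_comp e fun v => f v ^ 2]

namespace LabelledGraph

variable {V D E : Type} [Fintype D]

/-- The average over the neighbours. -/
noncomputable def avg (G : LabelledGraph V D) (f : V → ℝ) (v : V) : ℝ :=
  (∑ a, f (G.step a v)) / Fintype.card D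

theorem avg_add (G : LabelledGraph V D) (f g : V → ℝ) : G.avg (f + g) = G.avg f + G.avg g := by
  ext v; simp [avg, sum_add_distrib, add_div]

theorem avg_const [Nonempty D] (G : LabelledGraph V D) (c : ℝ) :
    G.avg (fun _ => c) = fun _ => c := by
  have : (Fintype.card D : ℝ) ≠ 0 := Nat.cast_ne_zero.2 Fintype.card_ne_zero
  ext v; simp only [avg, sum_const, card_univ, nsmul_eq_mul]
  field_simp

variable [Fintype V]

theorem sum_avg [Nonempty D] (G : LabelledGraph V D) (f : V → ℝ) :
    ∑ v, G.avg f v = ∑ v, f v := by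
  have : (Fintype.card D : ℝ) ≠ 0 := Nat.cast_ne_zero.2 Fintype.card_ne_zero
  simp only [avg]
  rw [← sum_div, sum_comm]
  simp only [Equiv.sum_comp (G.step _) f, sum_const, card_univ, nsmul_eq_mul]
  field_simp

theorem nrm_avg_le [Nonempty D] (G : LabelledGraph V D) (f : V → ℝ) : nrm (G.avg f) ≤ nrm f := by
  have hD : (0 : ℝ) < Fintype.card D := Nat.cast_pos.2 Fintype.card_pos
  have h : G.avg f = (Fintype.card D : ℝ)⁻¹ • ∑ a, fun v => f (G.step a v) := by
    ext v; simp [avg, div_eq_inv_mul]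
  rw [h, nrm_smul, abs_of_pos (inv_pos.2 hD), inv_mul_le_iff₀ hD]
  refine (nrm_sum_le _ _).trans (le_of_eq ?_)
  simp [nrm_comp_perm]

/-- The walk shrinks functions of mean zero by the factor `lam`. -/
def HasGap (G : LabelledGraph V D) (lam : ℝ) : Prop :=
  ∀ g : V → ℝ, ∑ v, g v = 0 → nrm (G.avg g) ≤ lam * nrm g

theorem sum_mul_avg (G : LabelledGraph V D) (f g : V → ℝ) :
    ∑ v, f v * G.avg g v = ∑ v, G.avg f v * g v := by
  have h : ∀ f g : V → ℝ, ∑ v, f v * G.avg g v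
      = (∑ a, ∑ v, f v * g (G.step a v)) / Fintype.card D := by
    intro f g
    simp only [avg, mul_div_assoc', mul_sum]
    rw [← sum_div, sum_comm]
  have h2 : ∑ v, G.avg f v * g v = ∑ v, g v * G.avg f v :=
    sum_congr rfl fun _ _ => mul_comm _ _
  rw [h2, h, h]
  congr 1
  rw [← Equiv.sum_comp (Function.Involutive.toPerm G.inv G.inv_inv)]
  refine sum_congr rfl fun a _ => ?_
  change ∑ v, f v * g (G.step (G.inv a) v) = _
  rw [← Equiv.sum_comp (G.step a)]
  refine sum_congr rfl fun v _ => ?_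
  rw [G.step_inv, Equiv.Perm.inv_def, Equiv.symm_apply_apply, mul_comm]

/-- The walk of two steps. -/
def square (G : LabelledGraph V D) : LabelledGraph V (D × D) where
  step x := G.step x.2 * G.step x.1
  inv x := (G.inv x.2, G.inv x.1)
  inv_inv x := by simp [G.inv_inv]
  step_inv x := by simp [G.step_inv]

omit [Fintype V] in
theorem square_avg (G : LabelledGraph V D) (f : V → ℝ) : G.square.avg f = G.avg (G.avg f) := by
  ext v
  simp only [avg, square, Fintype.sum_prod_type, Equiv.Perm.mul_apply, Fintype.card_prod,
    Nat.cast_mul, ← sum_div, div_div]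

theorem HasGap.square [Nonempty D] {G : LabelledGraph V D} {lam : ℝ} (hG : G.HasGap lam)
    (h0 : 0 ≤ lam) : G.square.HasGap (lam ^ 2) := by
  intro g hg
  rw [square_avg]
  have h1 := hG (G.avg g) (by rw [sum_avg, hg])
  have h2 := mul_le_mul_of_nonneg_left (hG g hg) h0
  linarith

/-- Renaming the vertices. -/
def congr {V' : Type} (G : LabelledGraph V D) (e : V ≃ V') : LabelledGraph V' D where
  step a := e.permCongr (G.step a)
  inv := G.inv
  inv_inv := G.inv_inv
  step_inv a := by rw [G.step_inv]; rfl

theorem HasGap.congr {V' : Type} [Fintype V'] {G : LabelledGraph V D} {lam : ℝ}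
    (hG : G.HasGap lam) (e : V ≃ V') : (G.congr e).HasGap lam := by
  have hn : ∀ f : V' → ℝ, nrm (fun v => f (e v)) = nrm f := fun f => by
    rw [nrm, nrm, Equiv.sum_comp e fun v => f v ^ 2]
  intro g hg
  have h := hG (fun v => g (e v)) (by rw [Equiv.sum_comp e g, hg])
  rw [hn g] at h
  refine le_trans (le_of_eq ?_) h
  rw [← hn]
  congr 1
  ext v
  simp [avg, LabelledGraph.congr]

section ZigZag

variable [Fintype E]

/-- Follow the edge of `G` whose label is the current second coordinate. -/
def crossPerm (G : LabelledGraph V D) : Equiv.Perm (V × D) :=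
  Function.Involutive.toPerm (fun x => (G.step x.2 x.1, G.inv x.2)) fun x => by
    simp [G.step_inv, G.inv_inv]

/-- The zig-zag product of Reingold, Vadhan and Wigderson: a step of the small graph `H` on the
second coordinate, a step of `G` along the label found there, and another step of `H`. -/
def zigzag (G : LabelledGraph V D) (H : LabelledGraph D E) : LabelledGraph (V × D) (E × E) where
  step x := Equiv.prodCongrRight (fun _ => H.step x.2) * G.crossPerm *
    Equiv.prodCongrRight (fun _ => H.step x.1)
  inv x := (H.inv x.2, H.inv x.1)
  inv_inv x := by simp [H.inv_inv]
  step_inv x := by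
    have h1 : ∀ a, (Equiv.prodCongrRight (fun _ : V => H.step (H.inv a)) : Equiv.Perm (V × D))
        = (Equiv.prodCongrRight (fun _ : V => H.step a) : Equiv.Perm (V × D))⁻¹ := by
      intro a
      rw [eq_inv_iff_mul_eq_one]
      ext v <;> simp [H.step_inv]
    have h2 : G.crossPerm = G.crossPerm⁻¹ := rfl
    simp only [h1, mul_inv_rev, mul_assoc]
    rw [← h2]

/-- The average of a function on `V × D` over the second coordinate. -/
noncomputable def fiberMean (f : V × D → ℝ) (x : V × D) : ℝ :=
  (∑ b, f (x.1, b)) / Fintype.card D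

/-- A step of `H` in the second coordinate. -/
noncomputable def fiberAvg (H : LabelledGraph D E) (f : V × D → ℝ) (x : V × D) : ℝ :=
  H.avg (fun b => f (x.1, b)) x.2

omit [Fintype D] [Fintype V] in
theorem fiberAvg_add (H : LabelledGraph D E) (f g : V × D → ℝ) :
    fiberAvg H (f + g) = fiberAvg H f + fiberAvg H g := by
  ext x
  exact congrFun (H.avg_add (fun b => f (x.1, b)) (fun b => g (x.1, b))) x.2

omit [Fintype V] in
theorem fiberAvg_fiberMean [Nonempty E] (H : LabelledGraph D E) (f : V × D → ℝ) :
    fiberAvg H (fiberMean f) = fiberMean f := by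
  ext x
  exact congrFun (H.avg_const (fiberMean f x)) x.2

omit [Fintype D] [Fintype V] in
theorem zigzag_avg (G : LabelledGraph V D) (H : LabelledGraph D E) (f : V × D → ℝ) :
    (G.zigzag H).avg f = fiberAvg H (fun x => fiberAvg H f (G.crossPerm x)) := by
  ext x
  simp only [avg, zigzag, fiberAvg, Fintype.sum_prod_type, Equiv.Perm.mul_apply,
    Fintype.card_prod, Nat.cast_mul, ← sum_div, div_div]
  rfl

theorem nrm_prod_le {f g : V × D → ℝ} {c : ℝ} (hc : 0 ≤ c)
    (h : ∀ v, nrm (fun b => f (v, b)) ≤ c * nrm (fun b => g (v, b))) : nrm f ≤ c * nrm g := by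
  refine nrm_le_of_sq_le hc ?_
  rw [Fintype.sum_prod_type, Fintype.sum_prod_type, mul_sum]
  refine sum_le_sum fun v _ => ?_
  rw [← nrm_sq, ← nrm_sq, ← mul_pow]
  exact pow_le_pow_left₀ (nrm_nonneg _) (h v) 2

theorem sum_sq_fiberMean_add [Nonempty D] (f : V × D → ℝ) :
    ∑ x, fiberMean f x ^ 2 + ∑ x, (f x - fiberMean f x) ^ 2 = ∑ x, f x ^ 2 := by
  have hD : (Fintype.card D : ℝ) ≠ 0 := Nat.cast_ne_zero.2 Fintype.card_ne_zero
  simp only [Fintype.sum_prod_type, ← sum_add_distrib]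
  refine sum_congr rfl fun v _ => ?_
  set m : ℝ := (∑ b, f (v, b)) / Fintype.card D with hm
  have h1 : ∀ b, fiberMean f (v, b) = m := fun b => rfl
  have h2 : ∑ b, f (v, b) = Fintype.card D * m := by rw [hm]; field_simp
  have h3 : ∀ b, m ^ 2 + (f (v, b) - m) ^ 2 = f (v, b) ^ 2 + (2 * m ^ 2 - 2 * m * f (v, b)) :=
    fun b => by ring
  simp only [h1, h3]
  rw [sum_add_distrib, sum_sub_distrib, ← mul_sum univ (fun b => f (v, b)) (2 * m), h2]
  simp only [sum_const, card_univ, nsmul_eq_mul]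
  ring

theorem nrm_fiberMean_le [Nonempty D] (f : V × D → ℝ) : nrm (fiberMean f) ≤ nrm f :=
  Real.sqrt_le_sqrt (by
    rw [← sum_sq_fiberMean_add f]
    exact le_add_of_nonneg_right (sum_nonneg fun _ _ => sq_nonneg _))

theorem nrm_sub_fiberMean_le [Nonempty D] (f : V × D → ℝ) :
    nrm (fun x => f x - fiberMean f x) ≤ nrm f :=
  Real.sqrt_le_sqrt (by
    rw [← sum_sq_fiberMean_add f]
    exact le_add_of_nonneg_left (sum_nonneg fun _ _ => sq_nonneg _))

theorem nrm_fiberAvg_le [Nonempty E] (H : LabelledGraph D E) (f : V × D → ℝ) :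
    nrm (fiberAvg H f) ≤ nrm f := by
  have := nrm_prod_le (f := fiberAvg H f) (g := f) zero_le_one fun v => by
    rw [one_mul]; exact H.nrm_avg_le fun b => f (v, b)
  rwa [one_mul] at this

theorem HasGap.nrm_fiberAvg_le [Nonempty D] {H : LabelledGraph D E} {lam : ℝ} (hH : H.HasGap lam)
    (h0 : 0 ≤ lam) (f : V × D → ℝ) :
    nrm (fiberAvg H fun x => f x - fiberMean f x) ≤ lam * nrm f := by
  have hD : (Fintype.card D : ℝ) ≠ 0 := Nat.cast_ne_zero.2 Fintype.card_ne_zero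
  refine (nrm_prod_le h0 fun v => ?_).trans
    (mul_le_mul_of_nonneg_left (nrm_sub_fiberMean_le f) h0)
  refine hH (fun b => f (v, b) - fiberMean f (v, b)) ?_
  simp only [fiberMean, sum_sub_distrib, sum_const, card_univ, nsmul_eq_mul]
  field_simp
  simp

theorem HasGap.nrm_fiberMean_cross_le [Nonempty D] {G : LabelledGraph V D} {lam : ℝ}
    (hG : G.HasGap lam) (h0 : 0 ≤ lam) (f : V × D → ℝ) (hf : ∑ x, f x = 0) :
    nrm (fiberMean fun x => fiberMean f (G.crossPerm x)) ≤ lam * nrm f := by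
  have hD : (0 : ℝ) < Fintype.card D := Nat.cast_pos.2 Fintype.card_pos
  set φ : V → ℝ := fun v => (∑ b, f (v, b)) / Fintype.card D with hφ
  have hφ0 : ∑ v, φ v = 0 := by
    simp only [hφ]
    rw [← sum_div, ← Fintype.sum_prod_type, hf, zero_div]
  have h1 : ∀ x : V × D, fiberMean (fun x => fiberMean f (G.crossPerm x)) x = G.avg φ x.1 :=
    fun x => rfl
  refine le_trans ?_ (mul_le_mul_of_nonneg_left (nrm_fiberMean_le f) h0)
  refine nrm_le_of_sq_le h0 ?_
  simp only [h1]
  have h2 : ∀ x : V × D, fiberMean f x = φ x.1 := fun x => rfl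
  simp only [h2, Fintype.sum_prod_type, sum_const, card_univ, nsmul_eq_mul, ← mul_sum]
  have h3 := pow_le_pow_left₀ (nrm_nonneg _) (hG φ hφ0) 2
  rw [mul_pow, nrm_sq, nrm_sq] at h3
  have h4 := mul_le_mul_of_nonneg_left h3 hD.le
  linarith

/-- Split a function into its mean over the fibres, on which `H` does nothing, and a part with mean
zero on each fibre, which `H` shrinks. On the former the middle step acts as `G`, up to a
function that the last step of `H` shrinks. -/
theorem HasGap.zigzag [Nonempty D] [Nonempty E] {G : LabelledGraph V D} {H : LabelledGraph D E}
    {lam μ : ℝ} (hG : G.HasGap lam) (hH : H.HasGap μ) (h0 : 0 ≤ lam) (h1 : 0 ≤ μ) :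
    (G.zigzag H).HasGap (lam + 2 * μ) := by
  intro f hf
  rw [zigzag_avg]
  set P := G.crossPerm
  set f₀ : V × D → ℝ := fun x => fiberMean f (P x) with hf₀
  set f₁ : V × D → ℝ := fun x => fiberAvg H (fun y => f y - fiberMean f y) (P x) with hf₁
  have hsplit : (fun x => fiberAvg H f (P x)) = f₀ + f₁ := by
    have : fiberAvg H f = fiberMean f + fiberAvg H (fun y => f y - fiberMean f y) := by
      conv_lhs => rw [show f = fiberMean f + fun y => f y - fiberMean f y by ext; simp]
      rw [fiberAvg_add, fiberAvg_fiberMean]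
    rw [this]; rfl
  have hsplit₀ : fiberAvg H f₀ = fiberMean f₀ + fiberAvg H (fun y => f₀ y - fiberMean f₀ y) := by
    conv_lhs => rw [show f₀ = fiberMean f₀ + fun y => f₀ y - fiberMean f₀ y by ext; simp]
    rw [fiberAvg_add, fiberAvg_fiberMean]
  rw [hsplit, fiberAvg_add, hsplit₀]
  have hf₀n : nrm f₀ ≤ nrm f := by
    rw [hf₀, nrm_comp_perm]; exact nrm_fiberMean_le f
  have e1 := hG.nrm_fiberMean_cross_le h0 f hf
  have e2 := (hH.nrm_fiberAvg_le h1 f₀).trans (mul_le_mul_of_nonneg_left hf₀n h1)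
  have e3 : nrm (fiberAvg H f₁) ≤ μ * nrm f := by
    refine (LabelledGraph.nrm_fiberAvg_le H f₁).trans ?_
    rw [hf₁, nrm_comp_perm]
    exact hH.nrm_fiberAvg_le h1 f
  refine (nrm_add_le _ _).trans ((add_le_add_left (nrm_add_le _ _) _).trans ?_)
  change nrm (fiberMean f₀) ≤ _ at e1
  linarith

/-- Squaring and a zig-zag product with a fixed graph `H` keep the degree and the spectral gap and
multiply the number of vertices by a constant. -/
theorem exists_family [Nonempty E] (H : LabelledGraph ((E × E) × (E × E)) E)
    (hH : H.HasGap (1 / 16)) (t : ℕ) :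
    ∃ (W : Type) (_ : Fintype W) (G : LabelledGraph W (E × E)),
      Fintype.card W = (Fintype.card E ^ 4) ^ t ∧ G.HasGap (1 / 4) := by
  induction t with
  | zero =>
    refine ⟨Unit, inferInstance, ⟨fun _ => 1, id, fun _ => rfl, fun _ => by simp⟩, by simp, ?_⟩
    intro g hg
    have h : g = 0 := by
      ext v; simpa using hg
    have : (0 : ℝ) ≤ 1 / 4 * nrm g := mul_nonneg (by norm_num) (nrm_nonneg _)
    refine le_trans (le_of_eq ?_) this
    rw [h]
    convert nrm_zero (V := Unit)
    ext v; simp [avg]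
  | succ t ih =>
    obtain ⟨W, _, G, hW, hG⟩ := ih
    refine ⟨W × ((E × E) × (E × E)), inferInstance, G.square.zigzag H, ?_, ?_⟩
    · rw [Fintype.card_prod, hW]; simp only [Fintype.card_prod]; ring
    · have h := (hG.square (by norm_num)).zigzag hH (by norm_num) (by norm_num)
      intro g hg
      refine (h g hg).trans (mul_le_mul_of_nonneg_right (by norm_num) (nrm_nonneg _))

end ZigZag

end LabelledGraph

/-! ### A base graph from the moment curve -/

namespace LabelledGraph

section Curve

variable {N : ℕ} {K : Type} [Field K] [Fintype K]

/-- The Cayley graph of `Kᴺ` whose generators are the multiples of the points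
`(1, x, …, x ^ (N - 1))` of the moment curve. -/
def momentGraph (N : ℕ) (K : Type) [Field K] : LabelledGraph (Fin N → K) (K × K) where
  step x := Equiv.addRight (x.2 • fun i : Fin N => x.1 ^ (i : ℕ))
  inv x := (x.1, -x.2)
  inv_inv x := by simp
  step_inv x := by ext v; simp [Equiv.Perm.inv_def]

/-- The sum of `f` over all translates by combinations of the points `X i` of the moment curve. -/
noncomputable def spanSum (f : (Fin N → K) → ℝ) {k : ℕ} (X : Fin k → K) (a : Fin N → K) : ℝ :=
  ∑ Y : Fin k → K, f (a + ∑ i, Y i • fun j : Fin N => X i ^ (j : ℕ))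

theorem sum_fin_succ {D : Type} [Fintype D] {k : ℕ} (f : (Fin (k + 1) → D) → ℝ) :
    ∑ s, f s = ∑ a, ∑ s : Fin k → D, f (Fin.cons a s) := by
  rw [← (Fin.consEquiv fun _ : Fin (k + 1) => D).sum_comp, Fintype.sum_prod_type]
  rfl

theorem iterate_avg_momentGraph (f : (Fin N → K) → ℝ) (k : ℕ) :
    ((momentGraph N K).avg)^[k] f
      = ((Fintype.card K : ℝ) ^ (2 * k))⁻¹ • ∑ X : Fin k → K, spanSum f X := by
  have hK : (Fintype.card K : ℝ) ≠ 0 := Nat.cast_ne_zero.2 Fintype.card_ne_zero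
  induction k with
  | zero => ext a; simp [spanSum]
  | succ k ih =>
    rw [Function.iterate_succ_apply', ih]
    ext a
    simp only [avg, momentGraph, Equiv.coe_addRight, Pi.smul_apply, Finset.sum_apply, smul_eq_mul,
      Fintype.sum_prod_type, ← mul_sum, Fintype.card_prod, Nat.cast_mul]
    have h : ∑ x : K, ∑ y : K, ∑ X : Fin k → K,
        spanSum f X (a + y • fun j : Fin N => x ^ (j : ℕ))
        = ∑ X : Fin (k + 1) → K, spanSum f X a := by
      rw [sum_fin_succ]
      refine sum_congr rfl fun x _ => ?_
      rw [sum_comm]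
      refine sum_congr rfl fun X _ => ?_
      simp only [spanSum]
      rw [sum_fin_succ]
      refine sum_congr rfl fun y _ => sum_congr rfl fun Y _ => ?_
      rw [Fin.sum_univ_succ]
      simp [add_assoc]
    rw [h, mul_add, pow_add]
    field_simp

theorem spanSum_eq_zero (f : (Fin N → K) → ℝ) (hf : ∑ v, f v = 0) {X : Fin N → K}
    (hX : Function.Injective X) : spanSum f X = 0 := by
  classical
  ext a
  have h1 : ∀ Y : Fin N → K, (∑ i, Y i • fun j : Fin N => X i ^ (j : ℕ))
      = Matrix.vecMul Y (Matrix.vandermonde X) := by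
    intro Y; ext j
    simp [Matrix.vecMul, dotProduct, Matrix.vandermonde]
  have h2 : Function.Injective fun Y : Fin N → K => Matrix.vecMul Y (Matrix.vandermonde X) := by
    rw [Matrix.vecMul_injective_iff_isUnit, Matrix.isUnit_iff_isUnit_det, isUnit_iff_ne_zero]
    exact Matrix.det_vandermonde_ne_zero_iff.2 hX
  have h3 : Function.Bijective fun Y : Fin N → K =>
      a + Matrix.vecMul Y (Matrix.vandermonde X) :=
    Finite.injective_iff_bijective.1 ((add_right_injective a).comp h2)
  simp only [spanSum, h1]
  rw [h3.sum_comp f, hf]; rfl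

theorem nrm_spanSum_le (f : (Fin N → K) → ℝ) {k : ℕ} (X : Fin k → K) :
    nrm (spanSum f X) ≤ (Fintype.card K : ℝ) ^ k * nrm f := by
  have h : spanSum f X = ∑ Y : Fin k → K,
      fun a => f (Equiv.addRight (∑ i, Y i • fun j : Fin N => X i ^ (j : ℕ)) a) := by
    ext a; simp [spanSum]
  rw [h]
  refine (nrm_sum_le _ _).trans (le_of_eq ?_)
  simp only [nrm_comp_perm]
  simp

/-- Any `N` distinct points of the moment curve span `Kᴺ`, so among the walks of `N` steps those
with distinct directions average a function over the whole space. -/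
theorem nrm_iterate_avg_momentGraph_le (f : (Fin N → K) → ℝ) (hf : ∑ v, f v = 0) :
    nrm (((momentGraph N K).avg)^[N] f) ≤ N ^ 2 / Fintype.card K * nrm f := by
  classical
  set q : ℝ := (Fintype.card K : ℝ) with hq
  have hK : 0 < q := Nat.cast_pos.2 Fintype.card_pos
  rw [iterate_avg_momentGraph, nrm_smul, abs_of_pos (by positivity)]
  have h1 : nrm (∑ X : Fin N → K, spanSum f X)
      ≤ (#{X : Fin N → K | ¬ Function.Injective X} : ℝ) * (q ^ N * nrm f) := by
    refine (nrm_sum_le _ _).trans ?_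
    rw [← sum_filter_add_sum_filter_not univ (fun X : Fin N → K => Function.Injective X)]
    rw [sum_eq_zero, zero_add, ← nsmul_eq_mul, ← sum_const]
    · exact sum_le_sum fun X _ => nrm_spanSum_le f X
    · intro X hX
      rw [spanSum_eq_zero f hf (mem_filter.1 hX).2, nrm_zero]
  have h2 : (#{X : Fin N → K | ¬ Function.Injective X} : ℝ) ≤ N ^ 2 / q * q ^ N := by
    have hinj : #{X : Fin N → K | Function.Injective X} = (Fintype.card K).descFactorial N := by
      rw [← Fintype.card_subtype, Fintype.card_congr (Equiv.subtypeInjectiveEquivEmbedding _ _),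
        Fintype.card_embedding_eq, Fintype.card_fin]
    have htot := card_filter_add_card_filter_not (s := (univ : Finset (Fin N → K)))
      (fun X : Fin N → K => Function.Injective X)
    rw [hinj, card_univ, Fintype.card_fun, Fintype.card_fin] at htot
    have htot' : ((Fintype.card K).descFactorial N : ℝ)
        + (#{X : Fin N → K | ¬ Function.Injective X} : ℝ) = q ^ N := by
      rw [hq]; exact_mod_cast htot
    by_cases hNq : (N : ℝ) ≤ q
    · have h3 : (q - N) ^ N ≤ ((Fintype.card K).descFactorial N : ℝ) := by
        have h4 := Nat.pow_sub_le_descFactorial (Fintype.card K) N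
        have h5 : (Fintype.card K - N) ^ N ≤ (Fintype.card K).descFactorial N :=
          (Nat.pow_le_pow_left (by omega) N).trans h4
        have h6 : N ≤ Fintype.card K := by rw [hq] at hNq; exact_mod_cast hNq
        rw [hq, ← Nat.cast_sub h6]; exact_mod_cast h5
      have h4 : (1 - N ^ 2 / q) * q ^ N ≤ (q - N) ^ N := by
        have h5 := one_add_mul_le_pow (a := -(N / q)) (by
          have : (N : ℝ) / q ≤ 1 := by rw [div_le_one hK]; exact hNq
          linarith) N
        have h6 : (q - N) ^ N = (1 + -(N / q)) ^ N * q ^ N := by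
          rw [← mul_pow]; congr 1; field_simp; ring
        rw [h6]
        refine mul_le_mul_of_nonneg_right (le_trans (le_of_eq ?_) h5) (by positivity)
        ring
      linarith
    · push Not at hNq
      have h3 : 1 ≤ (N : ℝ) ^ 2 / q := by
        rw [one_le_div hK]
        have hq1 : 1 ≤ q := by rw [hq]; exact_mod_cast Fintype.card_pos
        nlinarith
      have h4 : (0 : ℝ) ≤ (Fintype.card K).descFactorial N := Nat.cast_nonneg _
      have h5 := mul_le_mul_of_nonneg_right h3 (show 0 ≤ q ^ N by positivity)
      linarith
  have h3 := h1.trans (mul_le_mul_of_nonneg_right h2 (mul_nonneg (by positivity) (nrm_nonneg f)))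
  rw [inv_mul_le_iff₀ (by positivity)]
  refine h3.trans (le_of_eq ?_)
  rw [two_mul, pow_add]; ring

end Curve

variable {V D : Type} [Fintype V] [Fintype D]

theorem sum_mul_iterate_avg (G : LabelledGraph V D) (f g : V → ℝ) (k : ℕ) :
    ∑ v, f v * (G.avg^[k] g) v = ∑ v, (G.avg^[k] f) v * g v := by
  induction k generalizing f with
  | zero => rfl
  | succ k ih => rw [Function.iterate_succ_apply', sum_mul_avg, ih, Function.iterate_succ_apply]

/-- The walk operator is symmetric, so its norms grow log-convexly. -/
theorem nrm_iterate_avg_sq_le (G : LabelledGraph V D) (f : V → ℝ) (k : ℕ) :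
    nrm (G.avg^[k] f) ^ 2 ≤ nrm f * nrm (G.avg^[2 * k] f) := by
  have h : nrm (G.avg^[k] f) ^ 2 = ∑ v, f v * (G.avg^[2 * k] f) v := by
    rw [two_mul, Function.iterate_add_apply, sum_mul_iterate_avg, nrm_sq]
    exact sum_congr rfl fun _ _ => sq _
  rw [h]; exact sum_mul_le_nrm _ _

/-- A graph of the size and degree that the zig-zag construction needs. -/
theorem exists_base : ∃ (E : Type) (_ : Fintype E) (_ : Nontrivial E)
    (H : LabelledGraph ((E × E) × (E × E)) E), H.HasGap (1 / 16) := by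
  obtain ⟨p, hp, hprime⟩ := Nat.exists_infinite_primes (64 * 16 ^ 8)
  have : Fact p.Prime := ⟨hprime⟩
  have hcard : Fintype.card (Fin 8 → ZMod p)
      = Fintype.card (((ZMod p × ZMod p) × (ZMod p × ZMod p)) ×
        ((ZMod p × ZMod p) × (ZMod p × ZMod p))) := by
    simp only [Fintype.card_fun, Fintype.card_prod, Fintype.card_fin]; ring
  refine ⟨ZMod p × ZMod p, inferInstance, inferInstance,
    (momentGraph 8 (ZMod p)).congr (Fintype.equivOfCardEq hcard), HasGap.congr ?_ _⟩
  intro f hf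
  have h8 := nrm_iterate_avg_momentGraph_le f hf
  have hp' : ((8 : ℕ) : ℝ) ^ 2 / Fintype.card (ZMod p) ≤ (1 / 16) ^ 8 := by
    rw [ZMod.card, div_le_iff₀ (Nat.cast_pos.2 hprime.pos)]
    have : ((64 * 16 ^ 8 : ℕ) : ℝ) ≤ p := Nat.cast_le.2 hp
    push_cast at this ⊢
    linarith
  have h0 := nrm_nonneg f
  have h8' := h8.trans (mul_le_mul_of_nonneg_right hp' h0)
  set G := momentGraph 8 (ZMod p)
  have hroot : ∀ (k : ℕ) (c : ℝ), 0 ≤ c → nrm (G.avg^[2 * k] f) ≤ c ^ 2 * nrm f →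
      nrm (G.avg^[k] f) ≤ c * nrm f := by
    intro k c hc h
    refine abs_le_of_sq_le_sq' ?_ (mul_nonneg hc h0) |>.2
    have h1 := (G.nrm_iterate_avg_sq_le f k).trans (mul_le_mul_of_nonneg_left h h0)
    refine h1.trans (le_of_eq (by ring))
  have h4 := hroot 4 ((1 / 16) ^ 4) (by norm_num) (h8'.trans (by norm_num))
  have h2 := hroot 2 ((1 / 16) ^ 2) (by norm_num) (h4.trans (by norm_num))
  exact hroot 1 (1 / 16) (by norm_num) h2

end LabelledGraph

/-! ### Expanders of bounded degree on every vertex set -/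

namespace LabelledGraph

variable {W V D : Type} [Fintype W] [Fintype V] [Fintype D]

omit [Fintype W] [Fintype D] in
/-- Add vertices that only carry loops. -/
theorem exists_extend {X : Type} (G : LabelledGraph W D) (ι : W ↪ X) :
    ∃ G' : LabelledGraph X D, (∀ a w, G'.step a (ι w) = ι (G.step a w)) ∧
      ∀ a x, x ∉ Set.range ι → G'.step a x = x := by
  classical
  let e : W ≃ Set.range ι := Equiv.ofInjective ι ι.injective
  refine ⟨⟨fun a => (G.step a).extendDomain e, G.inv, G.inv_inv, fun a => ?_⟩,
    fun a w => ?_, fun a x hx => ?_⟩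
  · rw [G.step_inv, Equiv.Perm.extendDomain_inv]
  · exact Equiv.Perm.extendDomain_apply_image (G.step a) e w
  · exact Equiv.Perm.extendDomain_apply_not_subtype _ e hx

/-- In a graph with a spectral gap, a step of the walk reduces the second moment of a function by
a fixed fraction of its variance. -/
theorem HasGap.sum_avg_sq_le [Nonempty D] {G : LabelledGraph W D} (hG : G.HasGap (1 / 4))
    (f : W → ℝ) : ∃ μ : ℝ,
      ∑ w, G.avg f w ^ 2 ≤ ∑ w, f w ^ 2 - 15 / 16 * ∑ w, (f w - μ) ^ 2 := by
  rcases isEmpty_or_nonempty W with _ | _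
  · exact ⟨0, by simp⟩
  have hW : (Fintype.card W : ℝ) ≠ 0 := Nat.cast_ne_zero.2 Fintype.card_ne_zero
  set μ : ℝ := (∑ w, f w) / Fintype.card W with hμ
  set g : W → ℝ := fun w => f w - μ with hg
  have hg0 : ∑ w, g w = 0 := by
    simp only [hg, sum_sub_distrib, sum_const, card_univ, nsmul_eq_mul, hμ]
    field_simp
    simp
  have hfg : f = (fun _ => μ) + g := by ext w; simp [hg]
  have hav : ∀ w, G.avg f w = μ + G.avg g w := fun w => by
    rw [hfg, avg_add, avg_const]; rfl
  have hexp : ∀ h : W → ℝ, ∑ w, h w = 0 →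
      ∑ w, (μ + h w) ^ 2 = Fintype.card W * μ ^ 2 + ∑ w, h w ^ 2 := by
    intro h h0
    simp only [add_sq, sum_add_distrib, ← mul_sum, h0, sum_const, card_univ, nsmul_eq_mul]
    ring
  have h1 := pow_le_pow_left₀ (nrm_nonneg _) (hG g hg0) 2
  rw [mul_pow, nrm_sq, nrm_sq] at h1
  refine ⟨μ, ?_⟩
  have h2 : ∑ w, f w ^ 2 = ∑ w, (μ + g w) ^ 2 := by rw [hfg]; rfl
  rw [h2, hexp g hg0]
  simp only [hav]
  rw [hexp _ (by rw [sum_avg, hg0])]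
  change _ ≤ _ - 15 / 16 * ∑ w, g w ^ 2
  linarith

/-- Identify vertices of an expander `W`, at most `R` at a time, so as to obtain the vertex set `V`,
and make the result regular by loops. The edge multiplicities form a symmetric matrix `M` that
shrinks functions of mean zero. -/
theorem exists_quotient [Nonempty D] {R : ℕ} (G : LabelledGraph W D)
    (hG : G.HasGap (1 / 4))
    (ι : W ↪ V × Fin R) (hι : ∀ v, ∃ w, (ι w).1 = v) :
    ∃ M : Matrix V V ℕ, M.IsSymm ∧ (∀ u, ∑ v, M u v = R * Fintype.card D) ∧
      ∀ g : V → ℝ, ∑ v, g v = 0 →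
        ∑ u, (M.map (Nat.cast : ℕ → ℝ)).mulVec g u ^ 2
          ≤ (R * Fintype.card D) ^ 2 * (1 - 15 / (16 * R)) * ∑ v, g v ^ 2 := by
  classical
  have hD : (0 : ℝ) < Fintype.card D := Nat.cast_pos.2 Fintype.card_pos
  obtain ⟨G', hG'1, hG'2⟩ := G.exists_extend ι
  refine ⟨Matrix.of fun u v => #{x : Fin R × D | (G'.step x.2 (u, x.1)).1 = v}, ?_, ?_, ?_⟩
  · ext u v
    simp only [Matrix.transpose_apply, Matrix.of_apply]
    refine card_bij' (fun x _ => ((G'.step x.2 (v, x.1)).2, G'.inv x.2))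
      (fun x _ => ((G'.step x.2 (u, x.1)).2, G'.inv x.2)) ?_ ?_ ?_ ?_ <;>
    · rintro ⟨r, a⟩ h
      have h' := (mem_filter.1 h).2
      simp only [mem_filter, mem_univ, true_and, ← h', Prod.mk.eta, G'.step_inv, G'.inv_inv,
        Equiv.Perm.inv_def, Equiv.symm_apply_apply]
  · intro u
    have h := card_eq_sum_card_fiberwise (s := (univ : Finset (Fin R × D))) (t := univ)
      (f := fun x => (G'.step x.2 (u, x.1)).1) (by simp)
    rw [card_univ, Fintype.card_prod, Fintype.card_fin] at h
    exact h.symm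
  · intro g hg
    set h : V × Fin R → ℝ := G'.avg fun x => g x.1 with hh
    have hM : ∀ u, (Matrix.map (Matrix.of fun u v =>
        #{x : Fin R × D | (G'.step x.2 (u, x.1)).1 = v}) (Nat.cast : ℕ → ℝ)).mulVec g u
        = Fintype.card D * ∑ r, h (u, r) := by
      intro u
      have h1 : (Fintype.card D : ℝ) * ∑ r, h (u, r)
          = ∑ x : Fin R × D, g (G'.step x.2 (u, x.1)).1 := by
        rw [Fintype.sum_prod_type, mul_sum]
        refine sum_congr rfl fun r _ => ?_
        rw [hh, avg, mul_div_cancel₀ _ hD.ne']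
      rw [h1, ← sum_fiberwise univ (fun x : Fin R × D => (G'.step x.2 (u, x.1)).1)]
      refine sum_congr rfl fun v _ => ?_
      change ((#{x : Fin R × D | (G'.step x.2 (u, x.1)).1 = v} : ℕ) : ℝ) * g v = _
      rw [← nsmul_eq_mul, ← sum_const]
      exact sum_congr rfl fun x hx => by rw [(mem_filter.1 hx).2]
    have hR : ∀ u, (∑ r, h (u, r)) ^ 2 ≤ R * ∑ r, h (u, r) ^ 2 := by
      intro u
      have := sq_sum_le_card_mul_sum_sq (s := (univ : Finset (Fin R))) (f := fun r => h (u, r))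
      simpa using this
    obtain ⟨μ, hμ⟩ := hG.sum_avg_sq_le fun w => g (ι w).1
    have hdiff : ∑ x, (h x ^ 2 - g x.1 ^ 2)
        = ∑ w, (G.avg (fun w => g (ι w).1) w ^ 2 - g (ι w).1 ^ 2) := by
      refine (Fintype.sum_of_injective ι ι.injective _ _ (fun x hx => ?_) fun w => ?_).symm
      · have : h x = g x.1 := by
          have : h x = (∑ _a : D, g x.1) / Fintype.card D := by
            rw [hh, avg]
            exact congrArg (· / _) (sum_congr rfl fun a _ => by rw [hG'2 a x hx])
          rw [this, sum_const, card_univ, nsmul_eq_mul, mul_div_cancel_left₀ _ hD.ne']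
        rw [this, sub_self]
      · have : h (ι w) = G.avg (fun w => g (ι w).1) w := by
          rw [hh, avg, avg]
          exact congrArg (· / _) (sum_congr rfl fun a _ => by rw [hG'1 a w])
        rw [this]
    have hvar : ∑ v, g v ^ 2 ≤ ∑ w, (g (ι w).1 - μ) ^ 2 := by
      choose s hs using hι
      have hinj : Function.Injective s := fun u v huv => by rw [← hs u, ← hs v, huv]
      have h1 : ∑ v, (g v - μ) ^ 2 ≤ ∑ w, (g (ι w).1 - μ) ^ 2 := by
        have h2 : ∑ v, (g v - μ) ^ 2 = ∑ w ∈ univ.image s, (g (ι w).1 - μ) ^ 2 := by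
          rw [sum_image fun u _ v _ huv => hinj huv]
          exact sum_congr rfl fun v _ => by rw [hs]
        rw [h2]
        exact sum_le_sum_of_subset_of_nonneg (subset_univ _) fun _ _ _ => sq_nonneg _
      refine le_trans ?_ h1
      simp only [sub_sq, sum_add_distrib, sum_sub_distrib, mul_assoc, ← mul_sum, ← sum_mul, hg]
      simp only [zero_mul, mul_zero, sub_zero, sum_const, card_univ, nsmul_eq_mul]
      exact le_add_of_nonneg_right (by positivity)
    have hlift : ∑ x : V × Fin R, g x.1 ^ 2 = R * ∑ v, g v ^ 2 := by
      rw [Fintype.sum_prod_type, mul_sum]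
      exact sum_congr rfl fun v _ => by simp
    rw [sum_sub_distrib, sum_sub_distrib, hlift] at hdiff
    have hsq : ∑ x, h x ^ 2 ≤ (R - 15 / 16) * ∑ v, g v ^ 2 := by linarith
    simp only [hM, mul_pow]
    rw [← mul_sum]
    have h3 : ∑ u, (∑ r, h (u, r)) ^ 2 ≤ R * ∑ x, h x ^ 2 := by
      rw [Fintype.sum_prod_type, mul_sum]
      exact sum_le_sum fun u _ => hR u
    have h4 : R * ((R - 15 / 16) * ∑ v, g v ^ 2)
        = (R : ℝ) ^ 2 * (1 - 15 / (16 * R)) * ∑ v, g v ^ 2 := by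
      rcases eq_or_ne (R : ℝ) 0 with h | h
      · rw [h]; ring
      · field_simp
    calc _ ≤ (Fintype.card D : ℝ) ^ 2 * (R * ((R - 15 / 16) * ∑ v, g v ^ 2)) :=
          mul_le_mul_of_nonneg_left
            (h3.trans (mul_le_mul_of_nonneg_left hsq (Nat.cast_nonneg _))) (by positivity)
      _ = _ := by rw [h4]; ring

end LabelledGraph

namespace RegularGraph

variable {V : Type} [Fintype V]

/-- A symmetric matrix of natural numbers with constant row sums is the adjacency matrix of a
regular multigraph. -/
theorem exists_of_matrix {M : Matrix V V ℕ} (hM : M.IsSymm) {d : ℕ} (hd : 0 < d)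
    (hrow : ∀ u, ∑ v, M u v = d) :
    ∃ G : RegularGraph V d, G.adjMatrix = M.map (Nat.cast : ℕ → ℝ) := by
  have hcard : ∀ u, Fintype.card (Σ v, Fin (M u v)) = Fintype.card (Fin d) := by
    intro u; simp [hrow u]
  let e : ∀ u, (Σ v, Fin (M u v)) ≃ Fin d := fun u => Fintype.equivOfCardEq (hcard u)
  have hcount : ∀ u v, Nat.card {a : Fin d // ((e u).symm a).1 = v} = M u v := by
    intro u v
    have e1 : {a : Fin d // ((e u).symm a).1 = v} ≃ {x : Σ v, Fin (M u v) // x.1 = v} :=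
      (e u).symm.subtypeEquiv fun a => Iff.rfl
    rw [Nat.card_congr (e1.trans (Equiv.sigmaSubtype v)), Nat.card_eq_fintype_card,
      Fintype.card_fin]
  refine ⟨⟨fun u a => ((e u).symm a).1, fun u v => ?_, hd⟩, ?_⟩
  · rw [hcount, hcount, hM.apply]
  · ext u v
    simp only [adjMatrix, Matrix.of_apply, Matrix.map_apply, hcount]

/-- Powers of a symmetric matrix that shrinks functions of mean zero give expanders. -/
theorem exists_isExpander_of_matrix [DecidableEq V] {M : Matrix V V ℕ} (hM : M.IsSymm) {d k : ℕ}
    (hd : 0 < d) (hrow : ∀ u, ∑ v, M u v = d) {c : ℝ} (hc0 : 0 ≤ c) (hc : c ^ k ≤ 1 / 4)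
    (hgap : ∀ g : V → ℝ, ∑ v, g v = 0 →
      nrm ((M.map (Nat.cast : ℕ → ℝ)).mulVec g) ≤ d * c * nrm g) :
    ∃ G : RegularGraph V (d ^ k), G.IsExpander (1 / 4) := by
  have hsymm : (M ^ k).IsSymm := by
    rw [Matrix.IsSymm, Matrix.transpose_pow, hM.eq]
  have hrows : ∀ k u, ∑ v, (M ^ k) u v = d ^ k := by
    intro k
    induction k with
    | zero => intro u; simp [Matrix.one_apply]
    | succ k ih =>
      intro u
      simp only [pow_succ, Matrix.mul_apply]
      rw [sum_comm]
      simp only [← mul_sum, hrow, ← sum_mul, ih]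
  have hcol : ∀ v, ∑ u, M u v = d := fun v => by
    rw [← hrow v]; exact sum_congr rfl fun u _ => hM.apply v u
  have hiter : ∀ k (g : V → ℝ), ∑ v, g v = 0 →
      nrm (((M ^ k).map (Nat.cast : ℕ → ℝ)).mulVec g) ≤ (d * c) ^ k * nrm g := by
    intro k
    induction k with
    | zero =>
      intro g _
      have : ((M ^ 0).map (Nat.cast : ℕ → ℝ)) = 1 := by
        rw [pow_zero, Matrix.map_one _ Nat.cast_zero Nat.cast_one]
      rw [this, Matrix.one_mulVec, pow_zero, one_mul]
    | succ k ih =>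
      intro g hg
      have h1 : ((M ^ (k + 1)).map (Nat.cast : ℕ → ℝ)).mulVec g
          = ((M ^ k).map (Nat.cast : ℕ → ℝ)).mulVec ((M.map (Nat.cast : ℕ → ℝ)).mulVec g) := by
        rw [Matrix.mulVec_mulVec, pow_succ]
        congr 1
        exact Matrix.map_mul (f := Nat.castRingHom ℝ)
      have h2 : ∑ v, (M.map (Nat.cast : ℕ → ℝ)).mulVec g v = 0 := by
        simp only [Matrix.mulVec, dotProduct, Matrix.map_apply]
        rw [sum_comm]
        have h3 : ∀ v, ∑ u, (M u v : ℝ) = d := fun v => by exact_mod_cast hcol v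
        simp only [← sum_mul, h3, ← mul_sum, hg, mul_zero]
      rw [h1, pow_succ]
      refine (ih _ h2).trans ?_
      rw [mul_assoc]
      exact mul_le_mul_of_nonneg_left (hgap g hg) (by positivity)
  obtain ⟨G, hG⟩ := exists_of_matrix hsymm (pow_pos hd k) (hrows k)
  refine ⟨G, HasGap.isExpander (fun g hg => ?_) (by norm_num)⟩
  have hdk : (0 : ℝ) < (d : ℝ) ^ k := by positivity
  rw [nrm_avg, hG, Nat.cast_pow, inv_mul_le_iff₀ hdk]
  refine (hiter k g hg).trans ?_
  rw [mul_pow, mul_assoc]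
  exact mul_le_mul_of_nonneg_left (mul_le_mul_of_nonneg_right hc (nrm_nonneg _)) hdk.le

/-- There are expanders of bounded degree on every finite vertex set. -/
theorem exists_isExpander : ∃ d₀ : ℕ, ∀ (V : Type) [Fintype V] [Nontrivial V],
    ∃ d ≤ d₀, ∃ G : RegularGraph V d, G.IsExpander (1 / 4) := by
  classical
  obtain ⟨E, _, _, H, hH⟩ := LabelledGraph.exists_base
  set S : ℕ := Fintype.card E ^ 4 with hS
  have hS1 : 1 < S := Nat.one_lt_pow (by norm_num) Fintype.one_lt_card
  set c : ℝ := √(1 - 15 / (16 * S)) with hc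
  have hS1' : (1 : ℝ) < S := by exact_mod_cast hS1
  have hc1 : c < 1 := by
    rw [hc, Real.sqrt_lt' one_pos, one_pow]
    have : 0 < 15 / (16 * (S : ℝ)) := by positivity
    linarith
  have hcs : c ^ 2 = 1 - 15 / (16 * S) := by
    refine Real.sq_sqrt ?_
    rw [sub_nonneg, div_le_one (by positivity)]
    linarith
  obtain ⟨k, hk⟩ := exists_pow_lt_of_lt_one (show (0 : ℝ) < 1 / 4 by norm_num) hc1
  refine ⟨(S * Fintype.card (E × E)) ^ k, fun V _ _ => ⟨_, le_rfl, ?_⟩⟩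
  set q := Fintype.card V with hq
  have hq1 : 1 < q := Fintype.one_lt_card
  set t := Nat.clog S q with ht
  have h1 : q ≤ S ^ t := Nat.le_pow_clog hS1 q
  have h2 : S ^ t ≤ S * q := by
    have h3 := Nat.pow_pred_clog_lt_self hS1 hq1
    have h4 : 0 < t := Nat.clog_pos hS1 hq1
    obtain ⟨s, hs⟩ : ∃ s, t = s + 1 := ⟨t - 1, by omega⟩
    rw [← ht, hs] at h3
    rw [hs, pow_succ, mul_comm]
    exact Nat.mul_le_mul_left S (by simpa using h3.le)
  obtain ⟨W, _, G, hW, hG⟩ := LabelledGraph.exists_family H hH t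
  have hqpos : 0 < q := by omega
  let eW : W ≃ Fin (S ^ t) := Fintype.equivFinOfCardEq hW
  let eV : V ≃ Fin q := Fintype.equivFin V
  let ι : W ↪ V × Fin S := ⟨fun w => (eV.symm ⟨(eW w : ℕ) % q, Nat.mod_lt _ hqpos⟩,
      ⟨(eW w : ℕ) / q, by
        rw [Nat.div_lt_iff_lt_mul hqpos]; exact (eW w).2.trans_le h2⟩), fun w w' hww => by
    simp only [Prod.mk.injEq, EmbeddingLike.apply_eq_iff_eq, Fin.mk.injEq] at hww
    apply eW.injective
    apply Fin.ext
    rw [← Nat.mod_add_div (eW w : ℕ) q, ← Nat.mod_add_div (eW w' : ℕ) q, hww.1, hww.2]⟩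
  have hι : ∀ v, ∃ w, (ι w).1 = v := fun v => by
    refine ⟨eW.symm ⟨eV v, (eV v).2.trans_le h1⟩, (Equiv.symm_apply_eq eV).2 (Fin.ext ?_)⟩
    change (eW (eW.symm ⟨eV v, _⟩) : ℕ) % q = eV v
    rw [Equiv.apply_symm_apply]
    exact Nat.mod_eq_of_lt (eV v).2
  obtain ⟨M, hM, hrow, hgap⟩ := G.exists_quotient hG ι hι
  refine exists_isExpander_of_matrix hM (Nat.mul_pos (by omega) Fintype.card_pos) hrow
    (c := c) (Real.sqrt_nonneg _) hk.le fun g hg => nrm_le_of_sq_le (by positivity) ?_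
  refine (hgap g hg).trans (le_of_eq ?_)
  rw [← hcs]; push_cast; ring

end RegularGraph

/-! ### Linear codes and Reed–Solomon codes -/

section Codes

variable {F V : Type}

theorem codeRate_puncturedCode {n : ℕ} [Fintype F] {S : Finset (V → F)} {i : Fin n → V}
    (h : Set.InjOn (fun (u : V → F) (j : Fin n) => u (i j)) S) :
    codeRate (puncturedCode (S : Set (V → F)) i)
      = Real.log #S / (Real.log (Fintype.card F) * n) := by
  rw [codeRate, puncturedCode, h.ncard_image, Set.ncard_coe_finset,
    Nat.card_eq_fintype_card, Real.logb, div_div]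

/-- If `n = ⌈x⌉` with `x ≥ 1`, then `n` is at most `2 x`. -/
theorem ceil_le_two_mul {x : ℝ} (hx : 1 ≤ x) : (⌈x⌉₊ : ℝ) ≤ 2 * x := by
  have := (Nat.ceil_lt_add_one (by linarith : 0 ≤ x)).le
  linarith

theorem half_le_log_two : (1 : ℝ) / 2 ≤ Real.log 2 := by
  have := Real.log_two_gt_d9
  linarith

theorem half_le_log {x : ℝ} (hx : 2 ≤ x) : 1 / 2 ≤ Real.log x :=
  half_le_log_two.trans (Real.log_le_log (by norm_num) hx)

theorem card_agree_add_hammingDist [Fintype V] (u w : V → F) [DecidableEq F]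
    [DecidablePred fun v => u v = w v] :
    #{v | u v = w v} + hammingDist u w = Fintype.card V := by
  rw [hammingDist, ← card_univ,
    ← card_filter_add_card_filter_not (s := (univ : Finset V)) (fun v => u v = w v)]
  congr!

/-- The threshold in the list size: `(1 + α) ℓ` is where the number of collisions forced by lists
of size `ℓ` exceeds the number that two-wise agreement in a fraction `2 ε²` of the coordinates
accounts for. -/
theorem list_size_bound {η α ε ℓ L : ℝ} (hη0 : 0 < η) (hη : η ≤ 1 / 2) (hα0 : 0 < α)
    (hα : α ≤ 1) (hε : 0 < ε) (hℓ0 : 0 ≤ ℓ) (hℓ : ℓ ≤ α / (4 * ε ^ 2))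
    (hor : α ≤ 1 - η ∨ ℓ ≤ (1 - η) * (α / (4 * ε ^ 2))) (hL1 : 1 ≤ L)
    (hL : (1 + α) * ℓ < L) (hL' : L ≤ (1 + α) * ℓ + 1) :
    L * (L - 1) / 2 * (2 * ε ^ 2) * (1 + 3 * (η / 6)) ≤ L - ℓ := by
  have hε2 : 0 < 4 * ε ^ 2 := by positivity
  have key : (1 + α) ^ 2 * (ℓ * ε ^ 2) * (1 + η / 2) ≤ α := by
    rcases hor with h | h
    · have h1 : ℓ * ε ^ 2 ≤ α / 4 := by
        rw [le_div_iff₀ hε2] at hℓ; linarith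
      have h2 : (1 + α) ^ 2 ≤ (2 - η) ^ 2 := pow_le_pow_left₀ (by linarith) (by linarith) 2
      have h3 : (2 - η) ^ 2 * (1 + η / 2) ≤ 4 := by
        nlinarith [mul_nonneg hη0.le hη0.le, mul_nonneg (mul_nonneg hη0.le hη0.le) hη0.le]
      have h4 : (1 + α) ^ 2 * (1 + η / 2) ≤ 4 :=
        (mul_le_mul_of_nonneg_right h2 (by linarith)).trans h3
      calc _ = (1 + α) ^ 2 * (1 + η / 2) * (ℓ * ε ^ 2) := by ring
        _ ≤ 4 * (α / 4) := mul_le_mul h4 h1 (by positivity) (by norm_num)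
        _ = α := by ring
    · have h1 : ℓ * ε ^ 2 ≤ (1 - η) * (α / 4) := by
        have h2 := mul_le_mul_of_nonneg_right h (sq_nonneg ε)
        refine h2.trans (le_of_eq ?_)
        field_simp
      have h2 : (1 + α) ^ 2 * (1 + η / 2) ≤ 4 * (1 + η / 2) := by
        refine mul_le_mul_of_nonneg_right ?_ (by linarith)
        nlinarith
      calc _ = (1 + α) ^ 2 * (1 + η / 2) * (ℓ * ε ^ 2) := by ring
        _ ≤ 4 * (1 + η / 2) * ((1 - η) * (α / 4)) :=
          mul_le_mul h2 h1 (by positivity) (by linarith)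
        _ = α * ((1 + η / 2) * (1 - η)) := by ring
        _ ≤ α * 1 := mul_le_mul_of_nonneg_left (by nlinarith) hα0.le
        _ = α := mul_one α
  have h1 : (L - 1) * ε ^ 2 * (1 + η / 2) ≤ (1 + α) * (ℓ * ε ^ 2) * (1 + η / 2) := by
    refine mul_le_mul_of_nonneg_right ?_ (by linarith)
    have := mul_le_mul_of_nonneg_right (sub_le_iff_le_add.2 hL') (sq_nonneg ε)
    linarith
  have h2 : (1 + α) * ((L - 1) * ε ^ 2 * (1 + η / 2)) ≤ α := by
    refine (mul_le_mul_of_nonneg_left h1 (by linarith)).trans (le_trans (le_of_eq ?_) key)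
    ring
  have h3 : (1 + α) * (L * (L - 1) / 2 * (2 * ε ^ 2) * (1 + 3 * (η / 6))) ≤ (1 + α) * (L - ℓ) := by
    have := mul_le_mul_of_nonneg_left h2 (by linarith : 0 ≤ L)
    calc _ = L * ((1 + α) * ((L - 1) * ε ^ 2 * (1 + η / 2))) := by ring
      _ ≤ L * α := this
      _ ≤ (1 + α) * (L - ℓ) := by linarith
  exact le_of_mul_le_mul_left h3 (by linarith)

theorem one_div_card_le {q ε : ℝ} (hq : 0 < q) (h : 1 / √q ≤ ε) : 1 / q ≤ ε ^ 2 := by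
  have h1 : (1 / √q) ^ 2 ≤ ε ^ 2 := pow_le_pow_left₀ (by positivity) h 2
  rwa [div_pow, one_pow, Real.sq_sqrt hq.le] at h1

end Codes

section ReedSolomon

variable {F : Type} [Field F]

theorem mem_reedSolomon_iff {k : ℕ} {u : F → F} :
    u ∈ reedSolomon F k ↔ ∃ p : Polynomial F, p.degree < k ∧ (fun x => p.eval x) = u := by
  simp only [reedSolomon, Submodule.mem_map, Polynomial.mem_degreeLT]
  rfl

theorem natDegree_le_sub_one {p : Polynomial F} (hp : p ≠ 0) {k : ℕ} (h : p.degree < k) :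
    p.natDegree ≤ k - 1 := by
  have := (Polynomial.natDegree_lt_iff_degree_lt hp).2 h
  omega

variable [Fintype F]

open Classical in
theorem card_eval_eq_zero_le {p : Polynomial F} (hp : p ≠ 0) :
    #{v | p.eval v = 0} ≤ p.natDegree := by
  refine (card_le_card (t := p.roots.toFinset) fun v hv => ?_).trans
    ((Multiset.toFinset_card_le _).trans p.card_roots')
  rw [Multiset.mem_toFinset, Polynomial.mem_roots hp]
  exact (mem_filter.1 hv).2

open Classical in
/-- Two polynomials of degree less than `k` agree at no more than `k - 1` points. -/
theorem reedSolomon_agree {k : ℕ} {u w : F → F} (hu : u ∈ reedSolomon F k)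
    (hw : w ∈ reedSolomon F k) (hne : u ≠ w) : #{v | u v = w v} ≤ k - 1 := by
  obtain ⟨p, hp, rfl⟩ := mem_reedSolomon_iff.1 hu
  obtain ⟨p', hp', rfl⟩ := mem_reedSolomon_iff.1 hw
  have h0 : p - p' ≠ 0 := fun h => hne (by rw [sub_eq_zero.1 h])
  have h1 := card_eval_eq_zero_le h0
  have h2 := natDegree_le_sub_one h0 ((Polynomial.degree_sub_le p p').trans_lt (max_lt hp hp'))
  refine le_trans (le_of_eq ?_) (h1.trans h2)
  simp only [Polynomial.eval_sub, sub_eq_zero]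

theorem eval_injective {k : ℕ} (hk : k ≤ Fintype.card F) {p : Polynomial F} (hp : p.degree < k)
    (h : (fun x => p.eval x) = 0) : p = 0 := by
  classical
  by_contra h0
  have h1 := card_eval_eq_zero_le h0
  have h2 := (Polynomial.natDegree_lt_iff_degree_lt h0).2 hp
  have h3 : ∀ v, p.eval v = 0 := fun v => congrFun h v
  rw [filter_true_of_mem fun v _ => h3 v, card_univ] at h1
  omega

theorem card_reedSolomon {k : ℕ} (hk : k ≤ Fintype.card F) :
    Nat.card (reedSolomon F k) = Fintype.card F ^ k := by
  have hinj : Function.Injective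
      ((LinearMap.pi fun x : F => Polynomial.leval x).domRestrict (Polynomial.degreeLT F k)) := by
    rw [← LinearMap.ker_eq_bot, LinearMap.ker_eq_bot']
    rintro ⟨p, hp⟩ h
    exact Subtype.ext (eval_injective hk (Polynomial.mem_degreeLT.1 hp) h)
  have hrange : reedSolomon F k = LinearMap.range
      ((LinearMap.pi fun x : F => Polynomial.leval x).domRestrict (Polynomial.degreeLT F k)) := by
    rw [reedSolomon, LinearMap.range_domRestrict]
  rw [hrange, ← Nat.card_congr (LinearEquiv.ofInjective _ hinj).toEquiv,
    Nat.card_congr (Polynomial.degreeLTEquiv F k).toEquiv]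
  simp

/-- The product of `k - 1` linear factors vanishes at the first `k - 1` positions, so it is a
codeword of small weight. -/
theorem reedSolomon_beyondJohnson {k n : ℕ} (hk1 : 1 ≤ k) (hk : k ≤ Fintype.card F)
    (hkn : k - 1 ≤ n) (i : Fin n → F)
    (hinj : Set.InjOn (fun (u : F → F) (j : Fin n) => u (i j)) (reedSolomon F k)) {ℓ : ℝ}
    (h : 1 / ℓ * n ≤ (k : ℝ) - 1) :
    BeyondJohnson (puncturedCode (reedSolomon F k : Set (F → F)) i) ℓ := by
  classical
  set p : Polynomial F :=
    ∏ j : Fin (k - 1), (Polynomial.X - Polynomial.C (i (Fin.castLE hkn j))) with hp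
  have hmonic : p.Monic := Polynomial.monic_prod_of_monic _ _ fun j _ => Polynomial.monic_X_sub_C _
  have hdeg : p.degree < k := by
    rw [Polynomial.degree_lt_iff_coeff_zero]
    intro m hm
    refine Polynomial.coeff_eq_zero_of_natDegree_lt ?_
    rw [hp, Polynomial.natDegree_prod_of_monic _ _ fun j _ => Polynomial.monic_X_sub_C _]
    simp only [Polynomial.natDegree_X_sub_C, sum_const, card_univ, Fintype.card_fin, smul_eq_mul]
    omega
  have hmem : (fun x => p.eval x) ∈ reedSolomon F k := mem_reedSolomon_iff.2 ⟨p, hdeg, rfl⟩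
  have hzero : (0 : F → F) ∈ reedSolomon F k := Submodule.zero_mem _
  refine ⟨_, ⟨_, hmem, rfl⟩, _, ⟨_, hzero, rfl⟩, fun heq => ?_, ?_⟩
  · exact hmonic.ne_zero (eval_injective hk hdeg (hinj hmem hzero heq))
  · set c : Fin n → F := fun j => p.eval (i j) with hc
    set c' : Fin n → F := fun j => (0 : F → F) (i j) with hc'
    have h1 : k - 1 ≤ #{j | c j = c' j} := by
      have h2 : #(univ.image (Fin.castLE hkn)) = k - 1 := by
        rw [card_image_of_injective _ (Fin.castLE_injective hkn), card_univ, Fintype.card_fin]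
      rw [← h2]
      refine card_le_card fun j hj => ?_
      obtain ⟨j', -, rfl⟩ := mem_image.1 hj
      refine mem_filter.2 ⟨mem_univ _, ?_⟩
      simp only [hc, hc', hp, Polynomial.eval_prod, Pi.zero_apply]
      exact prod_eq_zero (mem_univ j') (by simp)
    have h2 := card_agree_add_hammingDist c c'
    rw [Fintype.card_fin] at h2
    have h3 : (hammingDist c c' : ℝ) + (k - 1) ≤ n := by
      have : hammingDist c c' + (k - 1) ≤ n := by omega
      have h4 : ((hammingDist c c' + (k - 1) : ℕ) : ℝ) ≤ n := by exact_mod_cast this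
      rw [Nat.cast_add, Nat.cast_sub hk1, Nat.cast_one] at h4
      exact h4
    linarith

end ReedSolomon

/-- Random walks give good puncturings of linear codes of large distance. -/
theorem linear_puncturing :
    ∃ c : ℝ, 0 < c ∧ ∀ η : ℝ, 0 < η → ∃ C ρ γ : ℝ, 0 < C ∧ 0 < ρ ∧ 0 < γ ∧
      ∀ (F : Type) [Field F] [Fintype F] [DecidableEq F]
        (m : ℕ) (D : Submodule F (Fin m → F)) (α ε ℓ K : ℝ) (n : ℕ),
        D ≠ ⊥ →
        0 < α → α ≤ 1 →
        1 / √(Fintype.card F : ℝ) ≤ ε → ε ≤ min c (α / 4) →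
        (∀ u ∈ D, ∀ v ∈ D, u ≠ v →
          (m : ℝ) * (1 - 1 / (Fintype.card F : ℝ) - ε ^ 2) ≤ (hammingDist u v : ℝ)) →
        ℓ ≤ α / (4 * ε ^ 2) →
        (α ≤ 1 - η ∨ ℓ ≤ (1 - η) * (α / (4 * ε ^ 2))) →
        C ≤ K → n = ⌈K * Real.log (Nat.card D : ℝ) / ε⌉₊ →
        ∀ (d : ℕ) (G : RegularGraph (Fin m) d), G.IsExpander (1 / 4) →
          1 - Real.exp (-γ * n) ≤ G.walkProb n fun i =>
            ρ * ε / (K * Real.log (Fintype.card F : ℝ)) ≤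
                codeRate (puncturedCode (D : Set (Fin m → F)) i) ∧
              ZeroErrorListRecoverable (puncturedCode (D : Set (Fin m → F)) i)
                ℓ ((1 + α) * ℓ) := by
  -- `ε ≤ 1 / 2` keeps the agreement bound `2 ε²` below `1 / 2`, as injectivity requires
  refine ⟨1 / 2, by norm_num, fun η₀ hη₀ => ?_⟩
  set η : ℝ := min η₀ (1 / 2) with hη
  have hη0 : 0 < η := lt_min hη₀ (by norm_num)
  have hη1 : η ≤ 1 / 2 := min_le_right _ _
  have hηη : η ≤ η₀ := min_le_left _ _
  -- the slack that `list_size_bound` leaves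
  set ξ : ℝ := η / 6 with hξ
  have hξ0 : 0 < ξ := by positivity
  have hξ1 : ξ ≤ 1 / 4 := by rw [hξ]; linarith
  refine ⟨256 / ξ ^ 4, 1 / 2, ξ ^ 4 / 128, by positivity, by norm_num, by positivity, ?_⟩
  intro F _ _ _ m D α ε ℓ K n hD hα0 hα1 hε hεc hdist hℓ hor hK hn d G hG
  have hεhalf : ε ≤ 1 / 2 := hεc.trans (min_le_left _ _)
  have hq0 : (0 : ℝ) < Fintype.card F := Nat.cast_pos.2 Fintype.card_pos
  have hq2 : (2 : ℝ) ≤ Fintype.card F := by exact_mod_cast Fintype.one_lt_card (α := F)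
  have hε0 : 0 < ε := lt_of_lt_of_le (by positivity) hε
  have hqε := one_div_card_le hq0 hε
  have hK1 : 256 ≤ K := by
    refine le_trans ?_ hK
    rw [le_div_iff₀ (by positivity)]
    have : ξ ^ 4 ≤ 1 := pow_le_one₀ hξ0.le (by linarith)
    linarith
  obtain ⟨S, hS⟩ : ∃ S : Finset (Fin m → F), (S : Set (Fin m → F)) = D :=
    (Set.toFinite (D : Set (Fin m → F))).exists_finset_coe
  have hmem : ∀ u, u ∈ S ↔ u ∈ D := fun u => by
    rw [← mem_coe, hS]; rfl
  have hcard : Nat.card D = #S := by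
    rw [← Set.ncard_coe_finset, hS]; rfl
  have hS2 : 2 ≤ #S := by
    have : Nontrivial D := Submodule.nontrivial_iff_ne_bot.2 hD
    rw [← hcard]
    exact Finite.one_lt_card
  have hm : Nonempty (Fin m) := by
    obtain ⟨u, -, hu⟩ := D.exists_mem_ne_zero_of_ne_bot hD
    obtain ⟨v, -⟩ := Function.ne_iff.1 hu
    exact ⟨v⟩
  have hlog := half_le_log (x := (#S : ℝ)) (by exact_mod_cast hS2)
  rw [hcard] at hn
  set x : ℝ := K * Real.log #S / ε with hx
  have hx1 : 1 ≤ x := by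
    rw [hx, one_le_div hε0]; nlinarith
  have hxn : x ≤ n := by rw [hn]; exact Nat.le_ceil x
  have hn2 : (n : ℝ) ≤ 2 * x := by rw [hn]; exact ceil_le_two_mul hx1
  have hn0 : 0 < n := by
    have : (0 : ℝ) < n := by linarith
    exact_mod_cast this
  have hxε : x * ε = K * Real.log #S := by rw [hx]; field_simp
  have hprob := G.walkProb_fewCollisions_ge (hG.hasGap (by norm_num) (by norm_num)) S hS2
    (θ := 2 * ε ^ 2) (K := K) hξ0 hξ1 hε0 (by linarith) (by nlinarith) (fun u hu w hw hne => by
      have h1 := card_agree_add_hammingDist u w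
      have h2 := hdist u ((hmem u).1 hu) w ((hmem w).1 hw) hne
      rw [Fintype.card_fin] at h1
      have h3 : (#{v | u v = w v} : ℝ) + hammingDist u w = m := by exact_mod_cast h1
      rw [Fintype.card_fin]
      have h4 : (#{v | u v = w v} : ℝ) ≤ 2 * ε ^ 2 * m := by
        have := mul_le_mul_of_nonneg_left hqε (Nat.cast_nonneg (α := ℝ) m)
        linarith
      convert h4) hK (by nlinarith)
  refine hprob.trans (G.walkProb_mono fun i hi => ?_)
  rw [← hS]
  constructor
  · rw [codeRate_puncturedCode (hi.injOn hξ0.le hξ1 (by nlinarith))]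
    have hlq : 0 < Real.log (Fintype.card F) := Real.log_pos (by linarith)
    have hnr : (0 : ℝ) < n := Nat.cast_pos.2 hn0
    rw [div_le_div_iff₀ (by positivity) (by positivity)]
    have h1 : ε * n ≤ 2 * (K * Real.log #S) := by nlinarith
    nlinarith
  · refine hi.zeroErrorListRecoverable hn0 hξ0 hξ1 (fun h => by nlinarith)
      fun h0 L hL1 hL hL' => ?_
    refine list_size_bound hη0 hη1 hα0 hα1 hε0 h0 hℓ ?_ hL1 hL hL'
    refine hor.imp (fun h => by linarith) fun h => h.trans ?_
    exact mul_le_mul_of_nonneg_right (by linarith) (by positivity)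

/-- Random walks give good evaluation points for Reed–Solomon codes. -/
theorem reedSolomon_puncturing :
    ∃ κ C ρ γ A B : ℝ, 0 < κ ∧ 0 < C ∧ 0 < ρ ∧ 0 < γ ∧ 0 < A ∧ 0 < B ∧ ∃ d₀ : ℕ,
      ∀ (F : Type) [Field F] [Fintype F] (ε : ℝ) (k n : ℕ),
        1 / √(Fintype.card F : ℝ) ≤ ε → ε ≤ 1 →
        1 ≤ k → (k : ℝ) - 1 ≤ κ * ε ^ 2 * (Fintype.card F : ℝ) →
        n = ⌈C * (k * Real.log (Fintype.card F : ℝ)) / ε⌉₊ →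
        (∃ d ≤ d₀, ∃ G : RegularGraph F d, G.IsExpander (1 / 4)) ∧
        (∀ d ≤ d₀, ∀ _G : RegularGraph F d,
          Real.logb 2 (Nat.card (WalkSeed F d n) : ℝ) ≤ B * n) ∧
        ∀ (d : ℕ) (G : RegularGraph F d), G.IsExpander (1 / 4) →
          1 - Real.exp (-γ * n) ≤ G.walkProb n fun i =>
            ρ * ε / Real.log (Fintype.card F : ℝ) ≤
                codeRate (puncturedCode (reedSolomon F k : Set (F → F)) i) ∧
              ZeroErrorListRecoverable (puncturedCode (reedSolomon F k : Set (F → F)) i)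
                (1 / ε ^ 2) (A / ε ^ 2) ∧
              (2 ≤ k → ε * Real.log (Fintype.card F : ℝ) ≤ ρ →
                BeyondJohnson (puncturedCode (reedSolomon F k : Set (F → F)) i)
                  (1 / ε ^ 2)) := by
  obtain ⟨d₀, hd₀⟩ := RegularGraph.exists_isExpander
  have hlogd : 0 ≤ Real.logb 2 (d₀ + 1) :=
    Real.logb_nonneg (by norm_num) (by linarith [Nat.cast_nonneg (α := ℝ) d₀])
  -- the constants `256 / ξ ^ 4` and `ξ ^ 4 / 128` of the general estimate, for `ξ = 1 / 4`
  set C : ℝ := 65536 with hC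
  refine ⟨1 / 4, C, 1 / (4 * C), 1 / 32768, 2, 2 + Real.logb 2 (d₀ + 1), by norm_num,
    by norm_num, by norm_num, by norm_num, by norm_num, by positivity, d₀, ?_⟩
  intro F _ _ ε k n hε hε1 hk1 hk hn
  have hq0 : (0 : ℝ) < Fintype.card F := Nat.cast_pos.2 Fintype.card_pos
  have hq2 : (2 : ℝ) ≤ Fintype.card F := by exact_mod_cast Fintype.one_lt_card (α := F)
  set q : ℝ := (Fintype.card F : ℝ) with hq
  have hε0 : 0 < ε := lt_of_lt_of_le (by positivity) hε
  have hlq := half_le_log hq2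
  have hk1' : (1 : ℝ) ≤ k := by exact_mod_cast hk1
  have hkq : k ≤ Fintype.card F := by
    have h1 : (k : ℝ) ≤ q := by
      have h2 : ε ^ 2 * q ≤ 1 * q := mul_le_mul_of_nonneg_right (by nlinarith) hq0.le
      linarith
    rw [hq] at h1; exact_mod_cast h1
  set x : ℝ := C * (k * Real.log q) / ε with hx
  have hkl : 1 / 2 * (k : ℝ) ≤ k * Real.log q := by nlinarith
  have hxε : x * ε = C * (k * Real.log q) := by rw [hx]; field_simp
  have hxbig : C * (k * Real.log q) ≤ x := by
    rw [hx, le_div_iff₀ hε0]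
    exact mul_le_of_le_one_right (by positivity) hε1
  have hx1 : 1 ≤ x := by rw [hC] at hxbig; linarith
  have hxn : x ≤ n := by rw [hn]; exact Nat.le_ceil x
  have hn2 : (n : ℝ) ≤ 2 * x := by rw [hn]; exact ceil_le_two_mul hx1
  have hnr : (0 : ℝ) < n := by linarith
  have hn0 : 0 < n := by exact_mod_cast hnr
  refine ⟨hd₀ F, fun d hd G => ?_, fun d G hG => ?_⟩
  · have hdpos : (1 : ℝ) ≤ d := by exact_mod_cast G.degree_pos
    have hdd : (d : ℝ) ≤ d₀ + 1 := by
      have : (d : ℝ) ≤ d₀ := by exact_mod_cast hd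
      linarith
    have hcard : (Nat.card (WalkSeed F d n) : ℝ) = q * (d : ℝ) ^ (n - 1) := by
      rw [Nat.card_eq_fintype_card, Fintype.card_prod]; simp [hq]
    rw [hcard, Real.logb_mul hq0.ne' (by positivity), Real.logb_pow]
    have h1 : Real.logb 2 q ≤ 2 * n := by
      rw [Real.logb, div_le_iff₀ (by linarith [half_le_log_two])]
      have h2 : Real.log q ≤ n := by
        have : Real.log q ≤ k * Real.log q := by nlinarith
        rw [hC] at hxbig
        linarith
      nlinarith [half_le_log_two]
    have h2 : Real.logb 2 d ≤ Real.logb 2 (d₀ + 1) :=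
      Real.logb_le_logb_of_le (by norm_num) (by linarith) hdd
    have h3 : ((n - 1 : ℕ) : ℝ) ≤ n := by exact_mod_cast Nat.sub_le n 1
    have h4 : ((n - 1 : ℕ) : ℝ) * Real.logb 2 d ≤ n * Real.logb 2 (d₀ + 1) :=
      mul_le_mul h3 h2 (Real.logb_nonneg (by norm_num) hdpos) (Nat.cast_nonneg _)
    linarith
  · obtain ⟨S, hS⟩ : ∃ S : Finset (F → F), (S : Set (F → F)) = reedSolomon F k :=
      (Set.toFinite (reedSolomon F k : Set (F → F))).exists_finset_coe
    have hmem : ∀ u, u ∈ S ↔ u ∈ reedSolomon F k := fun u => by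
      rw [← mem_coe, hS]; rfl
    have hcard : #S = Fintype.card F ^ k := by
      rw [← card_reedSolomon hkq, ← Set.ncard_coe_finset, hS]; rfl
    have hS2 : 2 ≤ #S := by
      rw [hcard]
      exact Nat.one_lt_pow (by omega) Fintype.one_lt_card
    have hlogS : Real.log #S = k * Real.log q := by
      rw [hcard, Nat.cast_pow, Real.log_pow]
    have hprob := G.walkProb_fewCollisions_ge (hG.hasGap (by norm_num) (by norm_num)) S hS2
      (θ := ε ^ 2 / 4) (ξ := 1 / 4) (K := C) (n := n) (by norm_num) le_rfl hε0 hε1 le_rfl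
      (fun u hu w hw hne => by
        have h1 := reedSolomon_agree ((hmem u).1 hu) ((hmem w).1 hw) hne
        have h2 : ((k - 1 : ℕ) : ℝ) = (k : ℝ) - 1 := by rw [Nat.cast_sub hk1, Nat.cast_one]
        have h3 := (Nat.cast_le (α := ℝ)).2 h1
        rw [h2] at h3
        linarith) (by norm_num [hC]) (by rw [hlogS, ← hxε]; nlinarith)
    refine le_trans (le_of_eq ?_) (hprob.trans (G.walkProb_mono fun i hi => ?_))
    · norm_num
    have hinj := hi.injOn (by norm_num) le_rfl (by nlinarith)
    have hεn : ε * n ≤ 2 * (C * (k * Real.log q)) := by nlinarith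
    refine ⟨?_, ?_, fun hk2 hρ => ?_⟩
    · rw [← hS, codeRate_puncturedCode hinj, hlogS,
        div_le_div_iff₀ (by linarith) (by positivity)]
      have h1 : 1 / (4 * C) * (ε * n) ≤ k * Real.log q := by
        rw [hC] at hεn ⊢
        linarith
      calc _ = Real.log q * (1 / (4 * C) * (ε * n)) := by rw [← hq]; ring
        _ ≤ Real.log q * (k * Real.log q) := mul_le_mul_of_nonneg_left h1 (by linarith)
        _ = _ := by ring
    · rw [← hS]
      have hℓ0 : 0 < 1 / ε ^ 2 := by positivity
      have h2ℓ : 2 / ε ^ 2 = 2 * (1 / ε ^ 2) := by ring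
      rw [h2ℓ]
      refine hi.zeroErrorListRecoverable hn0 (by norm_num) le_rfl (fun h => by linarith)
        fun _ L hL1 hL hL' => ?_
      have h1 : (L - 1) * ε ^ 2 ≤ 2 := by
        have := mul_le_mul_of_nonneg_right (sub_le_iff_le_add.2 hL') (sq_nonneg ε)
        refine this.trans (le_of_eq ?_)
        field_simp
      have h2 := mul_le_mul_of_nonneg_left h1 (by linarith : 0 ≤ L)
      linarith
    · refine reedSolomon_beyondJohnson hk1 hkq ?_ i (hS ▸ hinj) ?_
      · have h1 : ((k - 1 : ℕ) : ℝ) ≤ n := by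
          rw [Nat.cast_sub hk1, Nat.cast_one]
          rw [hC] at hxbig
          linarith
        exact_mod_cast h1
      · rw [one_div_one_div]
        have hk2' : (2 : ℝ) ≤ k := by exact_mod_cast hk2
        have h1 := mul_le_mul_of_nonneg_left hεn hε0.le
        have h2 := mul_le_mul_of_nonneg_left hρ (by linarith : (0 : ℝ) ≤ 2 * C * k)
        have h3 : 2 * C * k * (1 / (4 * C)) = k / 2 := by rw [hC]; ring
        rw [h3] at h2
        nlinarith

theorem theorem6p1 :
    -- puncturings of linear codes of large distance
    (∃ c : ℝ, 0 < c ∧ ∀ η : ℝ, 0 < η → ∃ C ρ γ : ℝ, 0 < C ∧ 0 < ρ ∧ 0 < γ ∧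
      ∀ (F : Type) [Field F] [Fintype F] [DecidableEq F]
        (m : ℕ) (D : Submodule F (Fin m → F)) (α ε ℓ K : ℝ) (n : ℕ),
        D ≠ ⊥ →
        0 < α → α ≤ 1 →
        1 / √(Fintype.card F : ℝ) ≤ ε → ε ≤ min c (α / 4) →
        (∀ u ∈ D, ∀ v ∈ D, u ≠ v →
          (m : ℝ) * (1 - 1 / (Fintype.card F : ℝ) - ε ^ 2) ≤ (hammingDist u v : ℝ)) →
        ℓ ≤ α / (4 * ε ^ 2) →
        (α ≤ 1 - η ∨ ℓ ≤ (1 - η) * (α / (4 * ε ^ 2))) →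
        C ≤ K → n = ⌈K * Real.log (Nat.card D : ℝ) / ε⌉₊ →
        ∀ (d : ℕ) (G : RegularGraph (Fin m) d), G.IsExpander (1 / 4) →
          1 - Real.exp (-γ * n) ≤ G.walkProb n fun i =>
            ρ * ε / (K * Real.log (Fintype.card F : ℝ)) ≤
                codeRate (puncturedCode (D : Set (Fin m → F)) i) ∧
              ZeroErrorListRecoverable (puncturedCode (D : Set (Fin m → F)) i)
                ℓ ((1 + α) * ℓ)) ∧
    -- Reed–Solomon codes
    (∃ κ C ρ γ A B : ℝ, 0 < κ ∧ 0 < C ∧ 0 < ρ ∧ 0 < γ ∧ 0 < A ∧ 0 < B ∧ ∃ d₀ : ℕ,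
      ∀ (F : Type) [Field F] [Fintype F] (ε : ℝ) (k n : ℕ),
        1 / √(Fintype.card F : ℝ) ≤ ε → ε ≤ 1 →
        1 ≤ k → (k : ℝ) - 1 ≤ κ * ε ^ 2 * (Fintype.card F : ℝ) →
        n = ⌈C * (k * Real.log (Fintype.card F : ℝ)) / ε⌉₊ →
        -- suitable expanders of bounded degree exist, and walks on them use `O(n)` random bits
        (∃ d ≤ d₀, ∃ G : RegularGraph F d, G.IsExpander (1 / 4)) ∧
        (∀ d ≤ d₀, ∀ _G : RegularGraph F d,
          Real.logb 2 (Nat.card (WalkSeed F d n) : ℝ) ≤ B * n) ∧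
        -- and a walk on any such expander gives a good code with high probability
        ∀ (d : ℕ) (G : RegularGraph F d), G.IsExpander (1 / 4) →
          1 - Real.exp (-γ * n) ≤ G.walkProb n fun i =>
            ρ * ε / Real.log (Fintype.card F : ℝ) ≤
                codeRate (puncturedCode (reedSolomon F k : Set (F → F)) i) ∧
              ZeroErrorListRecoverable (puncturedCode (reedSolomon F k : Set (F → F)) i)
                (1 / ε ^ 2) (A / ε ^ 2) ∧
              (2 ≤ k → ε * Real.log (Fintype.card F : ℝ) ≤ ρ →
                BeyondJohnson (puncturedCode (reedSolomon F k : Set (F → F)) i)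
                  (1 / ε ^ 2))) :=
  ⟨linear_puncturing, reedSolomon_puncturing⟩
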